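/- Let $\mathbb{T}\subseteq\mathbb{R}$ be a time scale (a nonempty closed set) with forward jump operator $\sigma(t)=\inf\{r\in\mathbb{T}: r>t\}$ and backward jump operator $\rho(t)=\sup\{r\in\mathbb{T}: r<t\}$ (with $\inf\emptyset=\sup\mathbb{T}$, $\sup\emptyset=\inf\mathbb{T}$), let $\mathbb{T}^\kappa$ be $\mathbb{T}$ without its maximum if that exists and is left-scattered, and $\mathbb{T}_\kappa$ be $\mathbb{T}$ without its minimum if that exists and is right-scattered. Let $\mathbb{T}^\star=\{s\in\mathbb{R}:-s\in\mathbb{T}\}$ be the dual time scale, with backward jump operator $\hat\rho$ and nabla derivative $\hat\nabla$, and for a function $f$ on $\mathbb{T}$ (or on $\mathbb{T}^\kappa$) let $f^\star(s)=f(-s)$. A function is called rd-continuous if it is continuous at the points with $\sigma(t)=t$ and has finite left-sided limits at the points with $\rho(t)=t$; ld-continuity is defined in the same way with left and right, and $\sigma$ and $\rho$, interchanged. Let $A:\mathbb{T}^\kappa\to\mathbb{R}^{n\times n}$ and $B:\mathbb{T}^\kappa\to\mathbb{R}^{n\times m}$ be rd-continuous, let $\bar A=-A^\star$, $\bar B=-B^\star$,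 let $v:(\mathbb{T}^\star)_\kappa\to\mathbb{R}^m$ be ld-continuous, and let $s_0\in\mathbb{T}^\star$, $x_0\in\mathbb{R}^n$. For $\tau\le t$ in $\mathbb{T}$ let $\Phi_A(t,\tau)$ be the value at $t$ of the forward solution on $[\tau,\infty)\cap\mathbb{T}$ of $X^\Delta=A X$, $X(\tau)=I$, and let $\Psi_{\bar A}(s,z)=\Phi_A(-s,-z)$ for $s\le z$ in $\mathbb{T}^\star$ be the dual transition function. Then the control system $$y^{\hat\nabla}(s)=\bar A(s)y(s)+\bar B(s)v(s),\quad s\in(\mathbb{T}^\star)_\kappa,\ s\le s_0,\qquad y(s_0)=x_0,$$ has a unique backward solution, that is, a unique solution $y$ on the time scale $(-\infty,s_0]\cap\mathbb{T}^\star$. For every $s\in\mathbb{T}^\star$ with $s\le s_0$ the integral below exists, and $$y(s)=\Psi_{\bar A}(s,s_0)x_0-\int_s^{s_0}\Psi_{\bar A}(s,\hat\rho(\varsigma))\,\bar B(\varsigma)v(\varsigma)\,\hat\nabla\varsigma .$$ Here $\int_a^b f\,\hat\nabla\varsigma=F(b)-F(a)$ for $F$ continuous on $[a,b]\cap\mathbb{T}^\star$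 with $F^{\hat\nabla}=f$ on $(a,b]\cap\mathbb{T}^\star$. -/

import Mathlib

open Set Filter Topology
open scoped Matrix

-- The norm on matrices is the maximum of the absolute values of the entries; all norms are
-- equivalent here, so delta derivatives of matrix functions do not depend on this choice.
attribute [local instance] Matrix.normedAddCommGroup Matrix.normedSpace

noncomputable section

namespace TimeScale

/-- A time scale is a nonempty closed subset of the real line. -/
def IsTimeScale (T : Set ℝ) : Prop := T.Nonempty ∧ IsClosed T

/-- The forward jump operator `σ(t) = inf {s ∈ T : s > t}`, where `σ(t) = t` if `t` is the
maximum of `T` (the convention `inf ∅ = sup T`). -/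
def sigma (T : Set ℝ) (t : ℝ) : ℝ :=
  open scoped Classical in if (T ∩ Ioi t).Nonempty then sInf (T ∩ Ioi t) else t

/-- The backward jump operator `ρ(t) = sup {s ∈ T : s < t}`, where `ρ(t) = t` if `t` is the
minimum of `T` (the convention `sup ∅ = inf T`). -/
def rho (T : Set ℝ) (t : ℝ) : ℝ :=
  open scoped Classical in if (T ∩ Iio t).Nonempty then sSup (T ∩ Iio t) else t

/-- `T^κ`: the time scale `T` without its maximum, if that exists and is left-scattered. -/
def upperKappa (T : Set ℝ) : Set ℝ := {t ∈ T | ¬ (IsGreatest T t ∧ rho T t < t)}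

/-- `T_κ`: the time scale `T` without its minimum, if that exists and is right-scattered. -/
def lowerKappa (T : Set ℝ) : Set ℝ := {t ∈ T | ¬ (IsLeast T t ∧ t < sigma T t)}

section Calculus

variable {E : Type*} [NormedAddCommGroup E] [NormedSpace ℝ E]

/-- `f` is delta differentiable at `t` with `f^Δ(t) = L`: for every `ε > 0`, all `s ∈ T` near `t`
satisfy `‖f(σ(t)) - f(s) - (σ(t) - s) L‖ ≤ ε |σ(t) - s|`. -/
def HasDeltaDerivAt (T : Set ℝ) (f : ℝ → E) (L : E) (t : ℝ) : Prop :=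
  ∀ ε > 0, ∀ᶠ s in 𝓝[T] t,
    ‖f (sigma T t) - f s - (sigma T t - s) • L‖ ≤ ε * |sigma T t - s|

/-- `f` is nabla differentiable at `t` with `f^∇(t) = L`: for every `ε > 0`, all `s ∈ T` near `t`
satisfy `‖f(ρ(t)) - f(s) - (ρ(t) - s) L‖ ≤ ε |ρ(t) - s|`. -/
def HasNablaDerivAt (T : Set ℝ) (f : ℝ → E) (L : E) (t : ℝ) : Prop :=
  ∀ ε > 0, ∀ᶠ s in 𝓝[T] t,
    ‖f (rho T t) - f s - (rho T t - s) • L‖ ≤ ε * |rho T t - s|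

/-- Rd-continuity on a subset `S` of the time scale `T` (used with `S = T^κ`): continuity at the
right-dense points (`σ(t) = t`), and finite left-sided limits at the left-dense points. -/
def RdContinuousOn (T S : Set ℝ) (f : ℝ → E) : Prop :=
  (∀ t ∈ S, sigma T t = t → ContinuousWithinAt f S t) ∧
  (∀ t ∈ S, rho T t = t → ∃ l : E, Tendsto f (𝓝[S ∩ Iio t] t) (𝓝 l))

/-- Ld-continuity on a subset `S` of the time scale `T` (used with `S = T_κ`): continuity at the
left-dense points (`ρ(t) = t`), and finite right-sided limits at the right-dense points. -/
def LdContinuousOn (T S : Set ℝ) (f : ℝ → E) : Prop :=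
  (∀ t ∈ S, rho T t = t → ContinuousWithinAt f S t) ∧
  (∀ t ∈ S, sigma T t = t → ∃ l : E, Tendsto f (𝓝[S ∩ Ioi t] t) (𝓝 l))

/-- `F` is a nabla antiderivative of `f` on `[a, b] ∩ T`: it is continuous there and
`F^∇ = f` on `(a, b] ∩ T`. The derivative is that of the time scale `[a, b] ∩ T`, whose backward
jump operator agrees with that of `T` on `(a, b] ∩ T` for `a ∈ T`. -/
def IsNablaAntideriv (T : Set ℝ) (f : ℝ → E) (a b : ℝ) (F : ℝ → E) : Prop :=
  ContinuousOn F (T ∩ Icc a b) ∧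
  ∀ s ∈ T ∩ Ioc a b, HasNablaDerivAt (T ∩ Icc a b) F (f s) s

/-- `f` has a nabla antiderivative on `[a, b] ∩ T`. -/
def NablaIntegrable (T : Set ℝ) (f : ℝ → E) (a b : ℝ) : Prop :=
  ∃ F : ℝ → E, IsNablaAntideriv T f a b F

/-- The nabla integral `∫_a^b f(s) ∇s = F(b) - F(a)`, for `a ≤ b` in `T`, where `F` is a nabla
antiderivative of `f` on `[a, b] ∩ T` (and `0` if there is none). -/
def nablaIntegral (T : Set ℝ) (f : ℝ → E) (a b : ℝ) : E :=
  open scoped Classical in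
  if h : NablaIntegrable T f a b then h.choose b - h.choose a else 0

/-- `x` is a forward solution of `x^Δ(t) = g(t, x(t))`, `t ∈ T^κ`, `t ≥ t₀`, with `x(t₀) = x₀`.
Only the values of `x` on `[t₀, ∞) ∩ T` matter. -/
def IsForwardSolution (T : Set ℝ) (g : ℝ → E → E) (t₀ : ℝ) (x₀ : E) (x : ℝ → E) : Prop :=
  x t₀ = x₀ ∧ ∀ t ∈ upperKappa T, t₀ ≤ t → HasDeltaDerivAt (T ∩ Ici t₀) x (g t (x t)) t

/-- `y` is a backward solution of `y^∇(s) = g(s, y(s))`, `s ∈ T_κ`, `s ≤ s₀`, with `y(s₀) = y₀`.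
Only the values of `y` on `(-∞, s₀] ∩ T` matter. -/
def IsBackwardSolution (T : Set ℝ) (g : ℝ → E → E) (s₀ : ℝ) (y₀ : E) (y : ℝ → E) : Prop :=
  y s₀ = y₀ ∧ ∀ s ∈ lowerKappa T, s ≤ s₀ → HasNablaDerivAt (T ∩ Iic s₀) y (g s (y s)) s

end Calculus

/-- The transition function `Φ_A(t, t₀)` on the time scale `T`: the value at `t ∈ T`, `t ≥ t₀`, of
the forward solution of the matrix equation `X^Δ(t) = A(t) X(t)`, `X(t₀) = I`. -/
def transition {n : ℕ} (T : Set ℝ) (A : ℝ → Matrix (Fin n) (Fin n) ℝ) (t t₀ : ℝ) :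
    Matrix (Fin n) (Fin n) ℝ :=
  Classical.epsilon (fun X : ℝ → Matrix (Fin n) (Fin n) ℝ =>
    IsForwardSolution T (fun τ M => A τ * M) t₀ 1 X) t

/-- The dual time scale `T⋆ = {s : -s ∈ T}`. -/
def dual (T : Set ℝ) : Set ℝ := {s | -s ∈ T}

/-- The dual function `f⋆(s) = f(-s)`. -/
def dualFun {α : Type*} (f : ℝ → α) : ℝ → α := fun s => f (-s)

/-- The transition function `Ψ` dual to `Φ_A`, for `Ā = -A⋆`: it is a function of two points of
the dual time scale `T⋆`, `Ψ(s, z) = Φ_A(-s, -z)` for `s ≤ z`. -/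
def dualTransition {n : ℕ} (T : Set ℝ) (A : ℝ → Matrix (Fin n) (Fin n) ℝ) (s z : ℝ) :
    Matrix (Fin n) (Fin n) ℝ :=
  transition T A (-s) (-z)

end TimeScale

end

open TimeScale

/-! The reflection `t ↦ -t` exchanges `σ` with `ρ` and changes the sign of derivatives. As `Ā = -A⋆`
and `B̄ = -B⋆`, backward solutions from `s₀` correspond to forward solutions of `x^Δ = A x + B v⋆`
from `a = -s₀`, so everything is proved forward in time on `T`.

Existence: a function on `T` is extended to the line by its value at the last point of `T` reached
so far (`lastPoint`). The extension of an rd-continuous function is continuous off a countable set,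
and its Lebesgue primitive has the right delta derivative (`hasDeltaDerivAt_integral`). The equation
becomes a Volterra equation with a delayed argument, solved by a Picard series
(`exists_continuous_volterra`). Uniqueness is Grönwall's inequality.

Formula: for fixed `b`, the function `τ ↦ Φ(b, τ) x(τ)` has delta derivative `Φ(b, σ(τ)) B(τ) v⋆(τ)`
(`hasDeltaDerivAt_apply_solution`), and its end values are `Φ(b, a) x₀` and `x(b)`. No regressivity
is assumed, so `Φ` may be singular. Hence the derivative comes neither from an inverse of `Φ` nor
from a product rule, but from Grönwall estimates and the forward cocycle identity. -/

namespace TimeScale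

/-! ### Jump operators and their behaviour under truncation. -/

section Jump

variable {T : Set ℝ} {a b s t : ℝ}

theorem le_sigma (T : Set ℝ) (t : ℝ) : t ≤ sigma T t := by
  unfold sigma
  split_ifs with h
  · exact le_csInf h fun s hs => hs.2.le
  · exact le_rfl

theorem sigma_le (hs : s ∈ T) (h : t < s) : sigma T t ≤ s := by
  unfold sigma
  rw [if_pos ⟨s, hs, h⟩]
  exact csInf_le ⟨t, fun r hr => hr.2.le⟩ ⟨hs, h⟩

theorem sigma_mem (hT : IsClosed T) (ht : t ∈ T) : sigma T t ∈ T := by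
  unfold sigma
  split_ifs with h
  · have := csInf_mem_closure h ⟨t, fun r hr => hr.2.le⟩
    exact hT.closure_subset_iff.2 inter_subset_left this
  · exact ht

theorem rho_le (T : Set ℝ) (t : ℝ) : rho T t ≤ t := by
  unfold rho
  split_ifs with h
  · exact csSup_le h fun s hs => hs.2.le
  · exact le_rfl

theorem le_rho (hs : s ∈ T) (h : s < t) : s ≤ rho T t := by
  unfold rho
  rw [if_pos ⟨s, hs, h⟩]
  exact le_csSup ⟨t, fun r hr => hr.2.le⟩ ⟨hs, h⟩

theorem sigma_inter_Ici (h : a ≤ t) : sigma (T ∩ Ici a) t = sigma T t := by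
  have : T ∩ Ici a ∩ Ioi t = T ∩ Ioi t := by
    ext s
    simp only [mem_inter_iff, mem_Ici, mem_Ioi]
    exact ⟨fun hs => ⟨hs.1.1, hs.2⟩, fun hs => ⟨⟨hs.1, h.trans hs.2.le⟩, hs.2⟩⟩
  unfold sigma
  rw [this]

/-- A jump from `t < b` lands at most at `b`, and a right-dense `t` is approached by points below
`b`. At `t = b` this fails, since `b` becomes the maximum. -/
theorem sigma_inter_Icc (hT : IsClosed T) (ht : t ∈ T) (hb : b ∈ T) (h : a ≤ t) (htb : t < b) :
    sigma (T ∩ Icc a b) t = sigma T t := by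
  apply le_antisymm
  · rcases (le_sigma T t).eq_or_lt with h1 | h1
    · rw [← h1]
      apply le_of_forall_gt_imp_ge_of_dense
      intro c hc
      have hne : (T ∩ Ioi t).Nonempty := ⟨b, hb, htb⟩
      have h2 : sInf (T ∩ Ioi t) < min b c := by
        have : sigma T t = sInf (T ∩ Ioi t) := if_pos hne
        rw [← this, ← h1]
        exact lt_min htb hc
      obtain ⟨d, hd, hdc⟩ := exists_lt_of_csInf_lt hne h2
      have hd2 : t < d := hd.2
      have hd3 : d ∈ T ∩ Icc a b := ⟨hd.1, h.trans hd2.le, (hdc.trans_le (min_le_left _ _)).le⟩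
      exact (sigma_le hd3 hd2).trans
        (hdc.trans_le (min_le_right _ _)).le
    · exact sigma_le ⟨sigma_mem hT ht, h.trans h1.le, sigma_le hb htb⟩ h1
  · have hne : (T ∩ Icc a b ∩ Ioi t).Nonempty := ⟨b, ⟨hb, h.trans htb.le, le_rfl⟩, htb⟩
    have : sigma (T ∩ Icc a b) t = sInf (T ∩ Icc a b ∩ Ioi t) := if_pos hne
    rw [this]
    exact le_csInf hne fun s hs => sigma_le hs.1.1 hs.2

theorem exists_mem_Ioo_of_sigma_eq (hb : b ∈ T) (htb : t < b) (h : sigma T t = t) {c : ℝ}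
    (hc : t < c) : ∃ s ∈ T, t < s ∧ s < c := by
  have hne : (T ∩ Ioi t).Nonempty := ⟨b, hb, htb⟩
  have h2 : sInf (T ∩ Ioi t) < c := by
    have : sigma T t = sInf (T ∩ Ioi t) := if_pos hne
    rwa [← this, h]
  obtain ⟨d, hd, hdc⟩ := exists_lt_of_csInf_lt hne h2
  exact ⟨d, hd.1, hd.2, hdc⟩

theorem sigma_eq_of_forall_exists (h : ∀ c, t < c → ∃ s ∈ T, t < s ∧ s < c) : sigma T t = t := by
  refine le_antisymm (le_of_forall_gt_imp_ge_of_dense fun c hc => ?_) (le_sigma T t)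
  obtain ⟨s, hs, h1, h2⟩ := h c hc
  exact (sigma_le hs h1).trans h2.le

theorem rho_eq_of_forall_exists (h : ∀ c, c < t → ∃ s ∈ T, c < s ∧ s < t) : rho T t = t := by
  refine le_antisymm (rho_le T t) (le_of_forall_lt_imp_le_of_dense fun c hc => ?_)
  obtain ⟨s, hs, h1, h2⟩ := h c hc
  exact h1.le.trans (le_rho hs h2)

theorem upperKappa_subset (T : Set ℝ) : upperKappa T ⊆ T := fun _ h => h.1

theorem mem_upperKappa_of_lt (ht : t ∈ T) (hb : b ∈ T) (h : t < b) : t ∈ upperKappa T :=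
  ⟨ht, fun h' => absurd (h'.1.2 hb) (not_le.2 h)⟩

theorem mem_upperKappa_of_rho_eq (ht : t ∈ T) (h : rho T t = t) : t ∈ upperKappa T :=
  ⟨ht, fun h' => h'.2.ne h⟩

theorem eventually_le_of_lt_sigma (h : t < sigma T t) : ∀ᶠ s in 𝓝[T] t, s ≤ t := by
  filter_upwards [self_mem_nhdsWithin, mem_nhdsWithin_of_mem_nhds (Iio_mem_nhds h)] with s hs hs'
  exact le_of_not_gt fun hts => absurd (sigma_le hs hts) (not_le.2 hs')

theorem eventually_ge_of_rho_lt (h : rho T t < t) : ∀ᶠ s in 𝓝[T] t, t ≤ s := by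
  filter_upwards [self_mem_nhdsWithin, mem_nhdsWithin_of_mem_nhds (Ioi_mem_nhds h)] with s hs hs'
  exact le_of_not_gt fun hts => absurd (le_rho hs hts) (not_le.2 hs')

/-- At most one point `M` is removed from `T`, and points near `t ≠ M` avoid it. -/
theorem nhdsWithin_upperKappa (ht : t ∈ upperKappa T) : 𝓝[upperKappa T] t = 𝓝[T] t := by
  refine le_antisymm (nhdsWithin_mono _ (upperKappa_subset T)) ?_
  by_cases h : ∃ M ∈ T, M ∉ upperKappa T
  · obtain ⟨M, hM, hM'⟩ := h
    have hne : t ≠ M := fun h => hM' (h ▸ ht)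
    refine le_inf inf_le_left (le_principal_iff.2 ?_)
    filter_upwards [self_mem_nhdsWithin, mem_nhdsWithin_of_mem_nhds (isOpen_ne.mem_nhds hne)]
      with s hs hsM
    rcases lt_or_gt_of_ne hsM with h | h
    · exact mem_upperKappa_of_lt hs hM h
    · exact absurd (mem_upperKappa_of_lt hM hs h) hM'
  · push Not at h
    exact nhdsWithin_mono _ h

end Jump

/-! ### Delta derivatives and Grönwall's inequality. -/

section Derivative

variable {E F : Type*} [NormedAddCommGroup E] [NormedSpace ℝ E] [NormedAddCommGroup F]
  [NormedSpace ℝ F] {S T : Set ℝ} {f g : ℝ → E} {L M : E} {a b t : ℝ}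

theorem HasDeltaDerivAt.mono (h : HasDeltaDerivAt T f L t) (hS : S ⊆ T)
    (hσ : sigma S t = sigma T t) : HasDeltaDerivAt S f L t := by
  intro ε hε
  rw [hσ]
  exact (h ε hε).filter_mono (nhdsWithin_mono _ hS)

/-- The defining estimate may be read at `s = t` itself, for every `ε`. -/
theorem HasDeltaDerivAt.apply_sigma (h : HasDeltaDerivAt T f L t) (ht : t ∈ T) :
    f (sigma T t) = f t + (sigma T t - t) • L := by
  have key : ∀ ε > 0, ‖f (sigma T t) - f t - (sigma T t - t) • L‖ ≤ ε * |sigma T t - t| :=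
    fun ε hε => (h ε hε).self_of_nhdsWithin ht
  have h0 : ‖f (sigma T t) - f t - (sigma T t - t) • L‖ ≤ 0 := by
    have : Tendsto (fun ε : ℝ => ε * |sigma T t - t|) (𝓝[>] 0) (𝓝 (0 * |sigma T t - t|)) :=
      ((continuous_id.mul continuous_const).tendsto 0).mono_left nhdsWithin_le_nhds
    rw [zero_mul] at this
    exact ge_of_tendsto this (eventually_mem_nhdsWithin.mono key)
  have := norm_le_zero_iff.1 h0
  rw [sub_sub, sub_eq_zero] at this
  exact this

theorem HasDeltaDerivAt.continuousWithinAt (h : HasDeltaDerivAt T f L t) (ht : t ∈ T) :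
    ContinuousWithinAt f T t := by
  have hσ := h.apply_sigma ht
  have key : ∀ ε > 0, ∀ᶠ s in 𝓝[T] t, ‖f s - f t‖ ≤ |s - t| * ‖L‖ + ε * |sigma T t - s| := by
    intro ε hε
    filter_upwards [h ε hε] with s hs
    have e : f s - f t = (s - t) • L - (f (sigma T t) - f s - (sigma T t - s) • L) := by
      rw [hσ]; module
    rw [e]
    refine (norm_sub_le _ _).trans (add_le_add ?_ hs)
    rw [norm_smul, Real.norm_eq_abs]
  rw [ContinuousWithinAt, Metric.tendsto_nhds]
  intro η hη
  set μ := |sigma T t - t| with hμ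
  have hμ0 : 0 ≤ μ := abs_nonneg _
  -- At a right-scattered point the error `ε * |σ(t) - s|` tends to `ε * μ` rather than to `0`, so
  -- `ε` must be chosen with `ε * μ < η`.
  have hε : 0 < η / (2 * (μ + 1)) := by positivity
  have hlim : Tendsto (fun s => |s - t| * ‖L‖ + η / (2 * (μ + 1)) * |sigma T t - s|) (𝓝[T] t)
      (𝓝 (|t - t| * ‖L‖ + η / (2 * (μ + 1)) * |sigma T t - t|)) := by
    refine Tendsto.mono_left (Continuous.tendsto ?_ t) nhdsWithin_le_nhds
    fun_prop
  have hlt : |t - t| * ‖L‖ + η / (2 * (μ + 1)) * |sigma T t - t| < η := by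
    rw [sub_self, abs_zero, zero_mul, zero_add, ← hμ, div_mul_eq_mul_div, div_lt_iff₀ (by positivity)]
    nlinarith
  filter_upwards [key _ hε, hlim.eventually (gt_mem_nhds hlt)] with s h1 h2
  rw [dist_eq_norm]
  exact h1.trans_lt h2

theorem hasDeltaDerivAt_of_lt_sigma (hc : ContinuousWithinAt f T t) (h : t < sigma T t)
    (hσ : f (sigma T t) = f t + (sigma T t - t) • L) : HasDeltaDerivAt T f L t := by
  intro ε hε
  have hlim : Tendsto (fun s => ‖f (sigma T t) - f s - (sigma T t - s) • L‖ - ε * |sigma T t - s|)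
      (𝓝[T] t) (𝓝 (‖f (sigma T t) - f t - (sigma T t - t) • L‖ - ε * |sigma T t - t|)) := by
    have h1 : ContinuousWithinAt (fun s : ℝ => (sigma T t - s)) T t :=
      (continuous_const.sub continuous_id).continuousWithinAt
    exact ((((continuousWithinAt_const.sub hc).sub (h1.smul continuousWithinAt_const)).norm).sub
      (continuousWithinAt_const.mul h1.abs))
  have hlt : ‖f (sigma T t) - f t - (sigma T t - t) • L‖ - ε * |sigma T t - t| < 0 := by
    rw [hσ, add_sub_cancel_left, sub_self, norm_zero, zero_sub, neg_lt_zero]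
    exact mul_pos hε (abs_pos.2 (sub_pos.2 h).ne')
  filter_upwards [hlim.eventually (gt_mem_nhds hlt)] with s hs
  linarith

theorem HasDeltaDerivAt.add (hf : HasDeltaDerivAt T f L t) (hg : HasDeltaDerivAt T g M t) :
    HasDeltaDerivAt T (fun s => f s + g s) (L + M) t := by
  intro ε hε
  filter_upwards [hf (ε / 2) (half_pos hε), hg (ε / 2) (half_pos hε)] with s h1 h2
  have e : f (sigma T t) + g (sigma T t) - (f s + g s) - (sigma T t - s) • (L + M) =
      (f (sigma T t) - f s - (sigma T t - s) • L) + (g (sigma T t) - g s - (sigma T t - s) • M) := by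
    module
  rw [e]
  refine (norm_add_le _ _).trans ((add_le_add h1 h2).trans_eq (by ring))

theorem HasDeltaDerivAt.clm_apply (hf : HasDeltaDerivAt T f L t) (φ : E →L[ℝ] F) :
    HasDeltaDerivAt T (fun s => φ (f s)) (φ L) t := by
  intro ε hε
  filter_upwards [hf (ε / (‖φ‖ + 1)) (by positivity)] with s hs
  have e : φ (f (sigma T t)) - φ (f s) - (sigma T t - s) • φ L =
      φ (f (sigma T t) - f s - (sigma T t - s) • L) := by simp
  rw [e]
  calc ‖φ (f (sigma T t) - f s - (sigma T t - s) • L)‖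
      ≤ ‖φ‖ * (ε / (‖φ‖ + 1) * |sigma T t - s|) := φ.le_opNorm_of_le hs
    _ = (‖φ‖ / (‖φ‖ + 1)) * (ε * |sigma T t - s|) := by ring
    _ ≤ 1 * (ε * |sigma T t - s|) := by
        gcongr
        rw [div_le_one (by positivity)]
        linarith
    _ = _ := one_mul _

theorem HasDeltaDerivAt.neg (hf : HasDeltaDerivAt T f L t) :
    HasDeltaDerivAt T (fun s => -f s) (-L) t := by
  simpa using hf.clm_apply (-ContinuousLinearMap.id ℝ E)

theorem HasDeltaDerivAt.sub (hf : HasDeltaDerivAt T f L t) (hg : HasDeltaDerivAt T g M t) :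
    HasDeltaDerivAt T (fun s => f s - g s) (L - M) t := by
  simpa [sub_eq_add_neg] using hf.add hg.neg

theorem hasDeltaDerivAt_const (T : Set ℝ) (c : E) (t : ℝ) :
    HasDeltaDerivAt T (fun _ => c) 0 t := by
  intro ε hε
  filter_upwards with s
  simp only [sub_self, smul_zero, norm_zero]
  positivity

theorem hasDeltaDerivAt_sub_smul_const (T : Set ℝ) (a : ℝ) (c : E) (t : ℝ) :
    HasDeltaDerivAt T (fun s => (s - a) • c) c t := by
  intro ε hε
  filter_upwards with s
  have : (sigma T t - a) • c - (s - a) • c - (sigma T t - s) • c = 0 := by module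
  rw [this, norm_zero]
  positivity

/-- A Grönwall inequality on a time scale. -/
theorem norm_le_of_norm_deltaDeriv_le (hS : IsClosed S) (ha : a ∈ S) (hb : b ∈ S) (hab : a ≤ b)
    {w w' : ℝ → E} {C c : ℝ} (hC : 0 ≤ C) (hc : 0 ≤ c) (hw : ContinuousOn w (S ∩ Icc a b))
    (hd : ∀ t ∈ S, a ≤ t → t < b → HasDeltaDerivAt S w (w' t) t)
    (hle : ∀ t ∈ S, a ≤ t → t < b → ‖w' t‖ ≤ C * ‖w t‖ + c) :
    ‖w b‖ ≤ (‖w a‖ + c * (b - a)) * Real.exp (C * (b - a)) := by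
  -- The slack `ε` pays for the error in the derivative. The bound `β` holds at a last point `m`; if
  -- `m < b`, it also holds at `σ(m)` or, when `m` is right-dense, at some later nearby point,
  -- contradicting maximality.
  have key : ∀ ε > 0, ‖w b‖ ≤ (‖w a‖ + (c + ε) * (b - a)) * Real.exp (C * (b - a)) := by
    intro ε hε
    set β : ℝ → ℝ := fun t => (‖w a‖ + (c + ε) * (t - a)) * Real.exp (C * (t - a)) with hβ
    have hβc : Continuous β := by rw [hβ]; fun_prop
    set W : Set ℝ := {t ∈ S ∩ Icc a b | ‖w t‖ ≤ β t} with hW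
    have hWc : IsCompact W := by
      refine (isCompact_Icc (a := a) (b := b)).of_isClosed_subset ?_ fun t ht => ht.1.2
      exact (hS.inter isClosed_Icc).isClosed_le hw.norm hβc.continuousOn
    have haW : a ∈ W := ⟨⟨ha, le_rfl, hab⟩, by simp [hβ]⟩
    have hm := hWc.sSup_mem ⟨a, haW⟩
    set m := sSup W
    have hmax : ∀ s ∈ W, s ≤ m := fun s hs => le_csSup hWc.bddAbove hs
    obtain ⟨⟨hmS, ham, hmb⟩, hmβ⟩ := hm
    rcases hmb.eq_or_lt with h | hmb
    · rw [h] at hmβ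
      exact hmβ
    exfalso
    have hder := hd m hmS ham hmb
    have hs : ∃ s ∈ S, m < s ∧ s ≤ b ∧ ‖w s - w m - (s - m) • w' m‖ ≤ ε * (s - m) := by
      rcases (le_sigma S m).eq_or_lt with h | h
      · obtain ⟨δ, hδ, hball⟩ := Metric.mem_nhdsWithin_iff.1 (hder ε hε)
        obtain ⟨s, hs, h1, h2⟩ := exists_mem_Ioo_of_sigma_eq hb hmb h.symm
          (lt_min hmb (lt_add_of_pos_right m hδ))
        refine ⟨s, hs, h1, (h2.trans_le (min_le_left _ _)).le, ?_⟩
        have h3 := hball ⟨by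
          rw [Metric.mem_ball, Real.dist_eq, abs_of_pos (sub_pos.2 h1)]
          linarith [h2.trans_le (min_le_right _ _)], hs⟩
        simp only [mem_ofPred_eq, ← h] at h3
        rw [abs_sub_comm, abs_of_pos (sub_pos.2 h1), ← norm_neg] at h3
        have e : w s - w m - (s - m) • w' m = -(w m - w s - (m - s) • w' m) := by module
        rw [e]
        exact h3
      · refine ⟨sigma S m, sigma_mem hS hmS, h, sigma_le hb hmb, ?_⟩
        rw [hder.apply_sigma hmS, add_sub_cancel_left, sub_self, norm_zero]
        exact mul_nonneg hε.le (sub_nonneg.2 h.le)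
    obtain ⟨s, hsS, hms, hsb, hws⟩ := hs
    refine absurd (hmax s ⟨⟨hsS, ham.trans hms.le, hsb⟩, ?_⟩) (not_le.2 hms)
    have hμ : 0 < s - m := sub_pos.2 hms
    have h1 : ‖w s‖ ≤ ‖w m‖ + (s - m) * (C * ‖w m‖ + c) + ε * (s - m) := by
      have e : w s = w m + (s - m) • w' m + (w s - w m - (s - m) • w' m) := by module
      rw [e]
      refine (norm_add_le _ _).trans (add_le_add ((norm_add_le _ _).trans ?_) hws)
      rw [norm_smul, Real.norm_eq_abs, abs_of_pos hμ]
      gcongr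
      exact hle m hmS ham hmb
    have h2 : 1 + C * (s - m) ≤ Real.exp (C * (s - m)) := by
      linarith [Real.add_one_le_exp (C * (s - m))]
    have h3 : 1 ≤ Real.exp (C * (s - a)) :=
      Real.one_le_exp (mul_nonneg hC (by linarith))
    have h4 : Real.exp (C * (s - a)) = Real.exp (C * (m - a)) * Real.exp (C * (s - m)) := by
      rw [← Real.exp_add]; ring_nf
    have h5 : 0 ≤ β m := (norm_nonneg _).trans hmβ
    calc ‖w s‖ ≤ ‖w m‖ * (1 + C * (s - m)) + (c + ε) * (s - m) := by linarith
      _ ≤ β m * (1 + C * (s - m)) + (c + ε) * (s - m) := by gcongr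
      _ ≤ β m * Real.exp (C * (s - m)) + (c + ε) * (s - m) * Real.exp (C * (s - a)) := by
          refine add_le_add (by gcongr) (le_mul_of_one_le_right (by positivity) h3)
      _ = β s := by
          simp only [hβ]
          rw [h4]
          ring
  have hlim : Tendsto (fun ε : ℝ => (‖w a‖ + (c + ε) * (b - a)) * Real.exp (C * (b - a))) (𝓝[>] 0)
      (𝓝 ((‖w a‖ + (c + 0) * (b - a)) * Real.exp (C * (b - a)))) := by
    refine Tendsto.mono_left (Continuous.tendsto ?_ 0) nhdsWithin_le_nhds
    fun_prop
  rw [add_zero] at hlim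
  exact ge_of_tendsto hlim (eventually_mem_nhdsWithin.mono key)

end Derivative

/-! ### Rd-continuity and local boundedness. -/

section RdContinuous

variable {E F G : Type*} [NormedAddCommGroup E] [NormedAddCommGroup F] [NormedAddCommGroup G] {T : Set ℝ} {f : ℝ → E} {g : ℝ → F}
  {a b t : ℝ}

/-- Rd-continuity of the restriction of `f` to `[a, ∞) ∩ T`, at the points of `T^κ`. -/
def RdContinuousFrom (T : Set ℝ) (a : ℝ) (f : ℝ → E) : Prop :=
  ∀ t ∈ upperKappa T, a ≤ t → (sigma T t = t → ContinuousWithinAt f (T ∩ Ici a) t) ∧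
    (rho T t = t → ∃ l : E, Tendsto f (𝓝[T ∩ Ico a t] t) (𝓝 l))

theorem RdContinuousOn.rdContinuousFrom (hf : RdContinuousOn T (upperKappa T) f) (a : ℝ) :
    RdContinuousFrom T a f := by
  intro t ht hat
  refine ⟨fun h => ?_, fun h => ?_⟩
  · have := hf.1 t ht h
    rw [ContinuousWithinAt, nhdsWithin_upperKappa ht] at this
    exact this.mono_left (nhdsWithin_mono _ inter_subset_left)
  · obtain ⟨l, hl⟩ := hf.2 t ht h
    refine ⟨l, hl.mono_left (nhdsWithin_mono _ ?_)⟩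
    exact fun s hs => ⟨mem_upperKappa_of_lt hs.1 ht.1 hs.2.2, hs.2.2⟩

theorem RdContinuousFrom.mono (hf : RdContinuousFrom T a f) (hab : a ≤ b) :
    RdContinuousFrom T b f := by
  intro t ht hbt
  obtain ⟨h1, h2⟩ := hf t ht (hab.trans hbt)
  refine ⟨fun h => (h1 h).mono (inter_subset_inter_right _ (Ici_subset_Ici.2 hab)), fun h => ?_⟩
  obtain ⟨l, hl⟩ := h2 h
  exact ⟨l, hl.mono_left (nhdsWithin_mono _ (inter_subset_inter_right _ (Ico_subset_Ico_left hab)))⟩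

theorem rdContinuousFrom_of_continuousOn (hf : ContinuousOn f (T ∩ Ici a)) :
    RdContinuousFrom T a f := by
  intro t ht hat
  have h := hf t ⟨ht.1, hat⟩
  exact ⟨fun _ => h, fun _ => ⟨f t, h.mono_left
    (nhdsWithin_mono _ (inter_subset_inter_right _ Ico_subset_Ici_self))⟩⟩

theorem RdContinuousFrom.comp₂ (hf : RdContinuousFrom T a f) (hg : RdContinuousFrom T a g)
    {φ : E → F → G} (hφ : Continuous fun x : E × F => φ x.1 x.2) :
    RdContinuousFrom T a fun t => φ (f t) (g t) := by
  intro t ht hat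
  obtain ⟨f1, f2⟩ := hf t ht hat
  obtain ⟨g1, g2⟩ := hg t ht hat
  refine ⟨fun h => (hφ.tendsto (f t, g t)).comp ((f1 h).prodMk_nhds (g1 h)), fun h => ?_⟩
  obtain ⟨l, hl⟩ := f2 h
  obtain ⟨k, hk⟩ := g2 h
  exact ⟨φ l k, (hφ.tendsto (l, k)).comp (hl.prodMk_nhds hk)⟩

/-- On each side of `t` either `f` has a limit or `T` has no points close to `t`; the value at `t`
is added separately. -/
theorem RdContinuousFrom.exists_eventually_norm_le (hf : RdContinuousFrom T a f) (ht : t ∈ T)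
    (hat : a ≤ t) : ∃ C, ∀ᶠ s in 𝓝[T ∩ Ici a] t, ‖f s‖ ≤ C := by
  have hl : ∃ C, ∀ᶠ s in 𝓝[T ∩ Ico a t] t, ‖f s‖ ≤ C := by
    rcases (rho_le T t).eq_or_lt with h | h
    · obtain ⟨l, hl⟩ := (hf t (mem_upperKappa_of_rho_eq ht h) hat).2 h
      exact ⟨‖l‖ + 1, hl.norm.eventually_le_const (lt_add_one _)⟩
    · refine ⟨0, ?_⟩
      filter_upwards [self_mem_nhdsWithin, (eventually_ge_of_rho_lt h).filter_mono
        (nhdsWithin_mono t (inter_subset_left (t := Ico a t)))] with s hs hs'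
      exact absurd hs' (not_le.2 hs.2.2)
  have hr : ∃ C, ∀ᶠ s in 𝓝[T ∩ Ioi t] t, ‖f s‖ ≤ C := by
    rcases (le_sigma T t).eq_or_lt with h | h
    · by_cases hκ : t ∈ upperKappa T
      · have := ((hf t hκ hat).1 h.symm).norm.eventually_le_const (lt_add_one _)
        exact ⟨_, this.filter_mono (nhdsWithin_mono _ fun s (hs : s ∈ T ∩ Ioi t) =>
          (⟨hs.1, hat.trans (le_of_lt hs.2)⟩ : s ∈ T ∩ Ici a))⟩
      · refine ⟨0, ?_⟩
        filter_upwards [self_mem_nhdsWithin] with s hs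
        exact absurd (mem_upperKappa_of_lt ht hs.1 hs.2) hκ
    · refine ⟨0, ?_⟩
      filter_upwards [self_mem_nhdsWithin, (eventually_le_of_lt_sigma h).filter_mono
        (nhdsWithin_mono t (inter_subset_left (t := Ioi t)))] with s hs hs'
      exact absurd hs' (not_le.2 hs.2)
  obtain ⟨C, hC⟩ := hl
  obtain ⟨D, hD⟩ := hr
  refine ⟨max (max C D) ‖f t‖, ?_⟩
  rw [eventually_nhdsWithin_iff] at *
  filter_upwards [hC, hD] with s h1 h2 hs
  rcases lt_trichotomy s t with h | h | h
  · exact (h1 ⟨hs.1, hs.2, h⟩).trans ((le_max_left _ _).trans (le_max_left _ _))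
  · rw [h]
    exact le_max_right _ _
  · exact (h2 ⟨hs.1, h⟩).trans ((le_max_right _ _).trans (le_max_left _ _))

theorem RdContinuousFrom.exists_norm_le (hf : RdContinuousFrom T a f) (hT : IsClosed T) (b : ℝ) :
    ∃ C, 0 ≤ C ∧ ∀ t ∈ T, a ≤ t → t ≤ b → ‖f t‖ ≤ C := by
  have hK : IsCompact (T ∩ Icc a b) := isCompact_Icc.inter_left hT
  suffices h : ∃ C, ∀ t ∈ T ∩ Icc a b, ‖f t‖ ≤ C by
    obtain ⟨C, hC⟩ := h
    exact ⟨max C 0, le_max_right _ _, fun t h1 h2 h3 => (hC t ⟨h1, h2, h3⟩).trans (le_max_left _ _)⟩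
  refine hK.induction_on (p := fun s => ∃ C, ∀ t ∈ s, ‖f t‖ ≤ C) ⟨0, by simp⟩ ?_ ?_ ?_
  · rintro s u hsu ⟨C, hC⟩
    exact ⟨C, fun t ht => hC t (hsu ht)⟩
  · rintro s u ⟨C, hC⟩ ⟨D, hD⟩
    refine ⟨max C D, fun t ht => ?_⟩
    rcases ht with h | h
    · exact (hC t h).trans (le_max_left _ _)
    · exact (hD t h).trans (le_max_right _ _)
  · intro t ht
    obtain ⟨C, hC⟩ := hf.exists_eventually_norm_le ht.1 ht.2.1
    exact ⟨{s | ‖f s‖ ≤ C}, hC.filter_mono (nhdsWithin_mono _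
      (inter_subset_inter_right _ Icc_subset_Ici_self)), C, fun s hs => hs⟩

end RdContinuous

/-! ### Extension of functions from the time scale to the line. -/

section LastPoint

variable {T : Set ℝ} {a b q s t : ℝ}

/-- The last point of `T` that is at most `max q a`. -/
noncomputable def lastPoint (T : Set ℝ) (a q : ℝ) : ℝ := sSup (T ∩ Iic (max q a))

theorem lastPoint_mem_and_le (hT : IsClosed T) (ha : a ∈ T) (q : ℝ) :
    lastPoint T a q ∈ T ∧ lastPoint T a q ≤ max q a := by
  have : sSup (T ∩ Iic (max q a)) ∈ T ∩ Iic (max q a) :=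
    (hT.inter isClosed_Iic).csSup_mem ⟨a, ha, le_max_right q a⟩ ⟨max q a, fun _ hs => hs.2⟩
  exact this

theorem lastPoint_le (hT : IsClosed T) (ha : a ∈ T) (hq : a ≤ q) : lastPoint T a q ≤ q :=
  (lastPoint_mem_and_le hT ha q).2.trans_eq (max_eq_left hq)

theorem le_lastPoint (hs : s ∈ T) (h : s ≤ max q a) : s ≤ lastPoint T a q :=
  le_csSup ⟨max q a, fun _ hr => hr.2⟩ ⟨hs, h⟩

theorem base_le_lastPoint (ha : a ∈ T) (q : ℝ) : a ≤ lastPoint T a q :=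
  le_lastPoint ha (le_max_right _ _)

theorem lastPoint_mono (hT : IsClosed T) (ha : a ∈ T) : Monotone (lastPoint T a) := fun q _ h =>
  le_lastPoint (lastPoint_mem_and_le hT ha q).1
    ((lastPoint_mem_and_le hT ha q).2.trans (max_le_max_right a h))

theorem lastPoint_of_mem (hT : IsClosed T) (ha : a ∈ T) (hq : q ∈ T) (haq : a ≤ q) :
    lastPoint T a q = q :=
  le_antisymm (lastPoint_le hT ha haq) (le_lastPoint hq (le_max_left _ _))

theorem lastPoint_eq_of_forall (hT : IsClosed T) (ha : a ∈ T) (ht : t ∈ T) (hat : a ≤ t)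
    (htq : t ≤ q) (h : ∀ s ∈ T, t < s → q < s) : lastPoint T a q = t := by
  refine le_antisymm (le_of_not_gt fun hlt => ?_) (le_lastPoint ht (htq.trans (le_max_left _ _)))
  exact absurd (h _ (lastPoint_mem_and_le hT ha q).1 hlt)
    (not_lt.2 (lastPoint_le hT ha (hat.trans htq)))

variable {E : Type*} [NormedAddCommGroup E] {f : ℝ → E}

theorem tendsto_lastPoint (hT : IsClosed T) (ha : a ∈ T) (hat : a < t)
    (h : ∀ c, c < t → ∃ s ∈ T, c < s ∧ s < t) :
    Tendsto (lastPoint T a) (𝓝 t) (𝓝[T ∩ Ici a] t) := by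
  refine tendsto_nhdsWithin_iff.2 ⟨?_, Eventually.of_forall fun q =>
    ⟨(lastPoint_mem_and_le hT ha q).1, base_le_lastPoint ha q⟩⟩
  rw [tendsto_order]
  constructor
  · intro c hc
    obtain ⟨s, hs, hcs, hst⟩ := h c hc
    filter_upwards [Ioi_mem_nhds hst] with q hq
    exact hcs.trans_le (le_lastPoint hs ((le_of_lt hq).trans (le_max_left _ _)))
  · intro c hc
    filter_upwards [Ioo_mem_nhds hat hc] with q hq
    exact (lastPoint_le hT ha hq.1.le).trans_lt hq.2

/-- Off `T` and below `a` the extension is locally constant. A point of `T` above `a` that is a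
limit from both sides is right-dense, so `f` is continuous there, and `lastPoint` tends to `t`. -/
theorem RdContinuousFrom.continuousAt_comp_lastPoint (hf : RdContinuousFrom T a f)
    (hT : IsClosed T) (ha : a ∈ T) (hta : t ≠ a)
    (hr : t ∈ T → 𝓝[T ∩ Ioi t] t ≠ ⊥) (hl : t ∈ T → 𝓝[T ∩ Iio t] t ≠ ⊥) :
    ContinuousAt (fun q => f (lastPoint T a q)) t := by
  rcases lt_or_gt_of_ne hta with h | h
  · refine (continuousAt_const (y := f a)).congr ?_
    filter_upwards [Iio_mem_nhds h] with q hq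
    congr 1
    refine le_antisymm (base_le_lastPoint ha q) ?_
    exact (lastPoint_mem_and_le hT ha q).2.trans_eq (max_eq_right (le_of_lt hq))
  by_cases ht : t ∈ T
  · have hr' : ∀ c, t < c → ∃ s ∈ T, t < s ∧ s < c := by
      intro c hc
      have : (𝓝[T ∩ Ioi t] t).NeBot := ⟨hr ht⟩
      have hev : ∀ᶠ s in 𝓝[T ∩ Ioi t] t, s ∈ T ∩ Ioi t ∧ s < c :=
        (eventually_mem_nhdsWithin).and (mem_nhdsWithin_of_mem_nhds (Iio_mem_nhds hc))
      obtain ⟨s, hs, hsc⟩ := hev.exists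
      exact ⟨s, hs.1, hs.2, hsc⟩
    have hl' : ∀ c, c < t → ∃ s ∈ T, c < s ∧ s < t := by
      intro c hc
      have : (𝓝[T ∩ Iio t] t).NeBot := ⟨hl ht⟩
      have hev : ∀ᶠ s in 𝓝[T ∩ Iio t] t, s ∈ T ∩ Iio t ∧ c < s :=
        (eventually_mem_nhdsWithin).and (mem_nhdsWithin_of_mem_nhds (Ioi_mem_nhds hc))
      obtain ⟨s, hs, hsc⟩ := hev.exists
      exact ⟨s, hs.1, hsc, hs.2⟩
    have hκ := mem_upperKappa_of_rho_eq ht (rho_eq_of_forall_exists hl')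
    have hc := (hf t hκ h.le).1 (sigma_eq_of_forall_exists hr')
    have := hc.tendsto.comp (tendsto_lastPoint hT ha h hl')
    rw [ContinuousAt, lastPoint_of_mem hT ha ht h.le]
    exact this
  · refine (continuousAt_const (y := f (lastPoint T a t))).congr ?_
    obtain ⟨δ, hδ, hball⟩ := Metric.mem_nhds_iff.1 (hT.isOpen_compl.mem_nhds ht)
    rw [Real.ball_eq_Ioo] at hball
    filter_upwards [Ioo_mem_nhds (sub_lt_self t hδ) (lt_add_of_pos_right t hδ), Ioi_mem_nhds h]
      with q hq hqa
    congr 1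
    have hqT := (lastPoint_mem_and_le hT ha q).1
    have htT := (lastPoint_mem_and_le hT ha t).1
    have hqle := lastPoint_le hT ha (le_of_lt hqa)
    have htle := lastPoint_le hT ha h.le
    refine le_antisymm (le_lastPoint htT ((le_of_not_gt fun h' => ?_).trans (le_max_left _ _)))
      (le_lastPoint hqT ((le_of_not_gt fun h' => ?_).trans (le_max_left _ _)))
    · exact hball ⟨hq.1.trans h', htle.trans_lt (lt_add_of_pos_right t hδ)⟩ htT
    · exact hball ⟨(sub_lt_self t hδ).trans h', hqle.trans_lt hq.2⟩ hqT

/-- Only countably many points of `T` are isolated from one side, so the extension is continuous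
almost everywhere. -/
theorem RdContinuousFrom.aestronglyMeasurable_comp_lastPoint (hf : RdContinuousFrom T a f)
    (hT : IsClosed T) (ha : a ∈ T) :
    MeasureTheory.AEStronglyMeasurable (fun q => f (lastPoint T a q)) := by
  set D : Set ℝ := {x ∈ T | 𝓝[T ∩ Ioi x] x = ⊥} ∪ {x ∈ T | 𝓝[T ∩ Iio x] x = ⊥} ∪ {a} with hD
  have hDc : D.Countable := (countable_setOfPred_isolated_right_within.union
    countable_setOfPred_isolated_left_within).union (countable_singleton a)
  have hcont : ContinuousOn (fun q => f (lastPoint T a q)) Dᶜ := by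
    intro t ht
    simp only [hD, mem_compl_iff, mem_union, not_or] at ht
    exact (hf.continuousAt_comp_lastPoint hT ha ht.2 (fun h h' => ht.1.1 ⟨h, h'⟩)
      fun h h' => ht.1.2 ⟨h, h'⟩).continuousWithinAt
  have h1 := hcont.aestronglyMeasurable (μ := MeasureTheory.volume) hDc.measurableSet.compl
  have h2 : (MeasureTheory.volume : MeasureTheory.Measure ℝ).restrict Dᶜ = MeasureTheory.volume :=
    MeasureTheory.Measure.restrict_eq_self_of_ae_mem (hDc.ae_notMem _)
  rwa [h2] at h1

theorem RdContinuousFrom.exists_norm_comp_lastPoint_le (hf : RdContinuousFrom T a f)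
    (hT : IsClosed T) (ha : a ∈ T) (b : ℝ) : ∃ C, ∀ q ≤ b, ‖f (lastPoint T a q)‖ ≤ C := by
  obtain ⟨C, -, hC⟩ := hf.exists_norm_le hT (max b a)
  exact ⟨C, fun q hq => hC _ (lastPoint_mem_and_le hT ha q).1 (base_le_lastPoint ha q)
    ((lastPoint_mem_and_le hT ha q).2.trans (max_le_max_right a hq))⟩

end LastPoint

/-! ### A Volterra equation with delayed argument. -/

section Volterra

open MeasureTheory

variable {E : Type*} [NormedAddCommGroup E] [NormedSpace ℝ E]

theorem intervalIntegrable_of_norm_le {E : Type*} [NormedAddCommGroup E] {f : ℝ → E} (hf : AEStronglyMeasurable f) {a b C : ℝ}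
    (h : ∀ q ∈ uIcc a b, ‖f q‖ ≤ C) : IntervalIntegrable f volume a b := by
  rw [intervalIntegrable_iff]
  refine Measure.integrableOn_of_bounded (M := C) (by simp) hf ?_
  exact (ae_restrict_mem measurableSet_uIoc).mono fun q hq => h q (uIoc_subset_uIcc hq)

theorem integral_mul_pow_div_factorial (a r c C : ℝ) (n : ℕ) :
    ∫ q in a..r, C * (c * (C * (q - a)) ^ n / n.factorial) =
      c * (C * (r - a)) ^ (n + 1) / (n + 1).factorial := by
  have hder : ∀ q ∈ uIcc a r, HasDerivAt (fun q => c * (C * (q - a)) ^ (n + 1) / (n + 1).factorial)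
      (C * (c * (C * (q - a)) ^ n / n.factorial)) q := by
    intro q _
    have h1 : HasDerivAt (fun q => C * (q - a)) C q := by
      simpa using ((hasDerivAt_id q).sub_const a).const_mul C
    refine (((h1.pow (n + 1)).const_mul c).div_const ((n + 1).factorial : ℝ)).congr_deriv ?_
    rw [Nat.factorial_succ]
    push_cast
    have : (n.factorial : ℝ) ≠ 0 := by positivity
    field_simp
  have hcont : Continuous fun q => C * (c * (C * (q - a)) ^ n / n.factorial) := by fun_prop
  rw [intervalIntegral.integral_eq_sub_of_hasDerivAt hder (hcont.intervalIntegrable a r)]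
  simp

theorem mul_pow_div_factorial_mono {a r s c C : ℝ} (hc : 0 ≤ c) (hC : 0 ≤ C) (has : a ≤ s)
    (hsr : s ≤ r) (n : ℕ) :
    c * (C * (s - a)) ^ n / n.factorial ≤ c * (C * (r - a)) ^ n / n.factorial := by
  have h0 : 0 ≤ C * (s - a) := mul_nonneg hC (sub_nonneg.2 has)
  gcongr

/-- The bound on the terms of the Picard series. -/
theorem norm_picard_le {p : ℝ → ℝ} {a b : ℝ} (hap : ∀ q, a ≤ q → a ≤ p q)
    (hpq : ∀ q, a ≤ q → p q ≤ q) {N : ℝ → E →L[ℝ] E} {Y : ℕ → ℝ → E} {c C : ℝ} (hc : 0 ≤ c)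
    (hC : 0 ≤ C) (hNC : ∀ q ≤ b, ‖N q‖ ≤ C) (hY0 : ∀ r ∈ Icc a b, ‖Y 0 r‖ ≤ c)
    (hYs : ∀ n r, Y (n + 1) r = ∫ q in a..r, N q (Y n (p q))) (n : ℕ) :
    ∀ r, a ≤ r → r ≤ b → ‖Y n r‖ ≤ c * (C * (r - a)) ^ n / n.factorial := by
  induction n with
  | zero =>
    intro r har hrb
    simpa using hY0 r ⟨har, hrb⟩
  | succ n ih =>
    intro r har hrb
    have hcont : Continuous fun q => C * (c * (C * (q - a)) ^ n / (n.factorial : ℝ)) := by fun_prop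
    rw [hYs, ← integral_mul_pow_div_factorial]
    refine intervalIntegral.norm_integral_le_of_norm_le har
      (Eventually.of_forall fun q hq => ?_) (hcont.intervalIntegrable a r)
    have hq1 : a ≤ q := hq.1.le
    have hq2 : q ≤ b := hq.2.trans hrb
    refine ((N q).le_opNorm _).trans (mul_le_mul (hNC q hq2) ?_ (norm_nonneg _) hC)
    exact (ih (p q) (hap q hq1) ((hpq q hq1).trans hq2)).trans
      (mul_pow_div_factorial_mono hc hC (hap q hq1) (hpq q hq1) n)

/-- The delay `p q ≤ q` does no harm, because the bounds `c (C (r - a))^n / n!` on the Picard terms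
increase with `r`. -/
theorem exists_continuous_volterra [CompleteSpace E] {p : ℝ → ℝ} {a : ℝ} (hp : Monotone p)
    (hap : ∀ q, a ≤ q → a ≤ p q) (hpq : ∀ q, a ≤ q → p q ≤ q) {N : ℝ → E →L[ℝ] E} {h : ℝ → E}
    (hN : AEStronglyMeasurable N) (hNb : ∀ b, ∃ C, ∀ q ≤ b, ‖N q‖ ≤ C)
    (hh : AEStronglyMeasurable h) (hhb : ∀ b, ∃ C, ∀ q ≤ b, ‖h q‖ ≤ C) (x₀ : E) :
    ∃ X : ℝ → E, Continuous X ∧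
      ∀ r, a ≤ r → X r = x₀ + ∫ q in a..r, (N q (X (p q)) + h q) := by
  have hmeas : ∀ Y : ℝ → E, Continuous Y → AEStronglyMeasurable fun q => N q (Y (p q)) := by
    intro Y hY
    have h1 : AEStronglyMeasurable fun q => Y (p q) :=
      hY.comp_aestronglyMeasurable hp.measurable.aestronglyMeasurable
    exact (continuous_fst.clm_apply continuous_snd).comp_aestronglyMeasurable (hN.prodMk h1)
  have hint : ∀ Y : ℝ → E, Continuous Y → ∀ c d,
      IntervalIntegrable (fun q => N q (Y (p q))) volume c d := by
    intro Y hY c d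
    obtain ⟨C, hC⟩ := hNb (max c d)
    obtain ⟨D, hD⟩ := (isCompact_Icc (a := p (min c d)) (b := p (max c d))).exists_bound_of_continuousOn
      hY.continuousOn
    refine intervalIntegrable_of_norm_le (hmeas Y hY) (C := C * D) fun q hq => ?_
    exact ((N q).le_opNorm _).trans (mul_le_mul (hC q hq.2) (hD _ ⟨hp hq.1, hp hq.2⟩)
      (norm_nonneg _) ((norm_nonneg _).trans (hC q hq.2)))
  have hhint : ∀ c d, IntervalIntegrable h volume c d := by
    intro c d
    obtain ⟨C, hC⟩ := hhb (max c d)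
    exact intervalIntegrable_of_norm_le hh fun q hq => hC q hq.2
  -- The `Y n` are the terms of the series, not the successive approximations.
  obtain ⟨Y, hY0, hYs⟩ : ∃ Y : ℕ → ℝ → E, (∀ r, Y 0 r = x₀ + ∫ q in a..r, h q) ∧
      ∀ n r, Y (n + 1) r = ∫ q in a..r, N q (Y n (p q)) :=
    ⟨fun n => Nat.rec (fun r => x₀ + ∫ q in a..r, h q)
      (fun _ Z r => ∫ q in a..r, N q (Z (p q))) n, fun _ => rfl, fun _ _ => rfl⟩
  have hYc : ∀ n, Continuous (Y n) := by
    intro n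
    induction n with
    | zero =>
      rw [funext hY0]
      exact continuous_const.add (intervalIntegral.continuous_primitive hhint a)
    | succ n ih =>
      rw [funext (hYs n)]
      exact intervalIntegral.continuous_primitive (hint _ ih) a
  have hbound : ∀ b, ∃ C c, 0 ≤ C ∧ 0 ≤ c ∧ (∀ q ≤ b, ‖N q‖ ≤ C) ∧
      ∀ n r, a ≤ r → r ≤ b → ‖Y n r‖ ≤ c * (C * (r - a)) ^ n / n.factorial := by
    intro b
    obtain ⟨C, hC⟩ := hNb b
    obtain ⟨c, hc⟩ := (isCompact_Icc (a := a) (b := b)).exists_bound_of_continuousOn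
      (hYc 0).continuousOn
    have hC' : ∀ q ≤ b, ‖N q‖ ≤ max C 0 := fun q hq => (hC q hq).trans (le_max_left _ _)
    exact ⟨max C 0, max c 0, le_max_right _ _, le_max_right _ _, hC',
      norm_picard_le hap hpq (le_max_right _ _) (le_max_right _ _) hC'
        (fun r hr => (hc r hr).trans (le_max_left _ _)) hYs⟩
  have hsum : ∀ c C r : ℝ, Summable fun n : ℕ => c * (C * (r - a)) ^ n / n.factorial := by
    intro c C r
    simpa only [mul_div_assoc] using (Real.summable_pow_div_factorial (C * (r - a))).mul_left c
  have hYsum : ∀ r, a ≤ r → Summable fun n => Y n r := by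
    intro r har
    obtain ⟨C, c, -, -, -, hb⟩ := hbound r
    exact Summable.of_norm_bounded (hsum c C r) fun n => hb n r har le_rfl
  -- The bounds hold only for `r ≥ a`; freezing the sum below `a` makes `X` continuous on the whole
  -- line.
  obtain ⟨X, hX⟩ : ∃ X : ℝ → E, ∀ r, X r = ∑' n, Y n (max a r) := ⟨_, fun _ => rfl⟩
  have hXa : ∀ r, a ≤ r → X r = ∑' n, Y n r := fun r har => by rw [hX, max_eq_right har]
  have hXc : Continuous X := by
    refine continuous_iff_continuousAt.2 fun r => ?_
    obtain ⟨C, c, hC, hc, -, hb⟩ := hbound (max a (r + 1))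
    have : ContinuousOn X (Iio (r + 1)) := by
      rw [funext hX]
      refine continuousOn_tsum (u := fun n => c * (C * (max a (r + 1) - a)) ^ n / n.factorial)
        (fun n => ((hYc n).comp (continuous_const.max continuous_id)).continuousOn)
        (hsum c C (max a (r + 1))) fun n s hs => ?_
      have hs' : max a s ≤ max a (r + 1) := max_le_max_left a (le_of_lt hs)
      have h0 : a ≤ max a s := le_max_left _ _
      exact (hb n _ h0 hs').trans (mul_pow_div_factorial_mono hc hC h0 hs' n)
    exact this.continuousAt (Iio_mem_nhds (by linarith))
  refine ⟨X, hXc, fun r har => ?_⟩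
  obtain ⟨C, c, hC, hc, hNC, hb⟩ := hbound r
  have hS : HasSum (fun n => ∫ q in a..r, N q (Y n (p q))) (∫ q in a..r, N q (X (p q))) := by
    refine intervalIntegral.hasSum_integral_of_dominated_convergence
      (fun n _ => C * (c * (C * (r - a)) ^ n / n.factorial))
      (fun n => (hmeas _ (hYc n)).restrict) (fun n => Eventually.of_forall fun q hq => ?_)
      (Eventually.of_forall fun q _ => (hsum c C r).mul_left C) (by simp)
      (Eventually.of_forall fun q hq => ?_)
    all_goals
      rw [uIoc_of_le har] at hq
      have hq1 := hap q hq.1.le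
      have hq2 := hpq q hq.1.le
    · refine ((N q).le_opNorm _).trans (mul_le_mul (hNC q hq.2) ?_ (norm_nonneg _) hC)
      exact (hb n _ hq1 (hq2.trans hq.2)).trans
        (mul_pow_div_factorial_mono hc hC hq1 (hq2.trans hq.2) n)
    · rw [hXa _ hq1]
      exact (hYsum _ hq1).hasSum.mapL (N q)
  rw [hXa r har, (hYsum r har).tsum_eq_zero_add, hY0, add_assoc,
    intervalIntegral.integral_add (hint X hXc a r) (hhint a r), add_comm (∫ q in a..r, h q)]
  congr 2
  simp only [hYs]
  exact hS.tsum_eq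

end Volterra

/-! ### Existence and uniqueness of forward solutions. -/

section Existence

theorem RdContinuousFrom.intervalIntegrable {E : Type*} [NormedAddCommGroup E] {T : Set ℝ}
    {f : ℝ → E} {a : ℝ} (hf : RdContinuousFrom T a f) (hT : IsClosed T)
    (ha : a ∈ T) (c d : ℝ) :
    IntervalIntegrable (fun q => f (lastPoint T a q)) MeasureTheory.volume c d := by
  obtain ⟨C, hC⟩ := hf.exists_norm_comp_lastPoint_le hT ha (max c d)
  exact intervalIntegrable_of_norm_le (hf.aestronglyMeasurable_comp_lastPoint hT ha)
    fun q hq => hC q hq.2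

variable {E : Type*} [NormedAddCommGroup E] [NormedSpace ℝ E] {T : Set ℝ} {f h : ℝ → E}
  {a b t : ℝ} {N : ℝ → E →L[ℝ] E} {x₀ : E} {x y : ℝ → E}

/-- On a gap `(t, σ(t))` the extension is constantly `f t`, so the increment is exact. Where `σ(t) =
t`, each `lastPoint T a q` with `q` between `s` and `t` lies between them too, and continuity of `f`
at `t` suffices. -/
theorem RdContinuousFrom.hasDeltaDerivAt_integral [CompleteSpace E] (hf : RdContinuousFrom T a f)
    (hT : IsClosed T) (ha : a ∈ T) (ht : t ∈ upperKappa T) (hat : a ≤ t) :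
    HasDeltaDerivAt (T ∩ Ici a) (fun r => ∫ q in a..r, f (lastPoint T a q)) (f t) t := by
  have hint := hf.intervalIntegrable hT ha
  rcases (le_sigma T t).eq_or_lt with h | h
  · intro ε hε
    rw [sigma_inter_Ici hat, ← h]
    obtain ⟨δ, hδ, hball⟩ := Metric.continuousWithinAt_iff.1 ((hf t ht hat).1 h.symm) ε hε
    filter_upwards [self_mem_nhdsWithin, mem_nhdsWithin_of_mem_nhds (Metric.ball_mem_nhds t hδ)]
      with s hs hst
    have e : (∫ q in a..t, f (lastPoint T a q)) - (∫ q in a..s, f (lastPoint T a q)) -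
        (t - s) • f t = ∫ q in s..t, (f (lastPoint T a q) - f t) := by
      rw [intervalIntegral.integral_sub (hint s t) (by simp),
        intervalIntegral.integral_interval_sub_left (hint a t) (hint a s),
        intervalIntegral.integral_const]
    rw [e]
    refine intervalIntegral.norm_integral_le_of_norm_le_const fun q hq => ?_
    rw [← dist_eq_norm]
    have hqm := uIoc_subset_uIcc hq
    have haq : a ≤ q := (le_min hs.2 hat).trans hqm.1
    refine (hball ⟨(lastPoint_mem_and_le hT ha q).1, base_le_lastPoint ha q⟩ ?_).le
    have h1 : min s t ≤ lastPoint T a q := by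
      have hqm' : min s t ≤ q := hqm.1
      rcases min_choice s t with h' | h' <;> rw [h'] at hqm' ⊢
      · exact le_lastPoint hs.1 (hqm'.trans (le_max_left _ _))
      · exact le_lastPoint ht.1 (hqm'.trans (le_max_left _ _))
    have h2 : lastPoint T a q ≤ max s t := (lastPoint_le hT ha haq).trans hqm.2
    rw [Metric.mem_ball] at hst
    refine lt_of_le_of_lt ?_ hst
    rw [Real.dist_eq, Real.dist_eq, abs_sub_comm, abs_sub_comm s]
    exact abs_sub_right_of_mem_uIcc ⟨h1, h2⟩
  · refine hasDeltaDerivAt_of_lt_sigma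
      (intervalIntegral.continuous_primitive hint a).continuousWithinAt
      (by rwa [sigma_inter_Ici hat]) ?_
    rw [sigma_inter_Ici hat, ← intervalIntegral.integral_add_adjacent_intervals (hint a t) (hint t _)]
    congr 1
    rw [intervalIntegral.integral_of_le h.le, MeasureTheory.integral_Ioc_eq_integral_Ioo,
      MeasureTheory.setIntegral_congr_fun (g := fun _ => f t) measurableSet_Ioo]
    · simp [h.le]
    · intro q hq
      exact congrArg f (lastPoint_eq_of_forall hT ha ht.1 hat hq.1.le
        fun s hs hts => hq.2.trans_le (sigma_le hs hts))

/-- With the delay `p = lastPoint T a`, the Volterra integrand is the extension of `N X + h`, whose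
primitive has the required derivative. -/
theorem exists_isForwardSolution [CompleteSpace E] (hT : IsClosed T) (ha : a ∈ T)
    (hN : RdContinuousFrom T a N) (hh : RdContinuousFrom T a h) (x₀ : E) :
    ∃ x, IsForwardSolution T (fun t w => N t w + h t) a x₀ x := by
  obtain ⟨X, hX, hXeq⟩ := exists_continuous_volterra (lastPoint_mono hT ha)
    (fun q _ => base_le_lastPoint ha q) (fun q hq => lastPoint_le hT ha hq)
    (hN.aestronglyMeasurable_comp_lastPoint hT ha) (hN.exists_norm_comp_lastPoint_le hT ha)
    (hh.aestronglyMeasurable_comp_lastPoint hT ha) (hh.exists_norm_comp_lastPoint_le hT ha) x₀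
  have hg : RdContinuousFrom T a fun t => N t (X t) + h t :=
    (hN.comp₂ (rdContinuousFrom_of_continuousOn hX.continuousOn)
      (φ := fun (L : E →L[ℝ] E) v => L v) (continuous_fst.clm_apply continuous_snd)).comp₂ hh
      (φ := fun u v => u + v) (continuous_fst.add continuous_snd)
  refine ⟨X, by simp [hXeq a le_rfl], fun t ht hat => ?_⟩
  have h1 := (hasDeltaDerivAt_const (T ∩ Ici a) x₀ t).add
    (hg.hasDeltaDerivAt_integral hT ha ht hat)
  rw [zero_add] at h1
  intro ε hε
  filter_upwards [h1 ε hε, self_mem_nhdsWithin] with s hs hsm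
  rw [hXeq s hsm.2, hXeq _ ((hat.trans (le_sigma T t)).trans_eq (sigma_inter_Ici hat).symm)]
  exact hs

/-- The only point without a derivative is a left-scattered maximum, which is isolated in `T`. -/
theorem IsForwardSolution.continuousOn {g : ℝ → E → E} (hx : IsForwardSolution T g a x₀ x) :
    ContinuousOn x (T ∩ Ici a) := by
  rintro t ⟨ht, hat⟩
  by_cases hκ : t ∈ upperKappa T
  · exact (hx.2 t hκ hat).continuousWithinAt ⟨ht, hat⟩
  · have hmax : IsGreatest T t ∧ rho T t < t := by
      by_contra h'
      exact hκ ⟨ht, h'⟩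
    refine tendsto_const_nhds.congr' ?_
    filter_upwards [self_mem_nhdsWithin, (eventually_ge_of_rho_lt hmax.2).filter_mono
      (nhdsWithin_mono t (inter_subset_left (t := Ici a)))] with s hs hs'
    rw [le_antisymm (hmax.1.2 hs.1) hs']

theorem IsForwardSolution.hasDeltaDerivAt_Ici {g : ℝ → E → E} (hx : IsForwardSolution T g a x₀ x)
    (ht : t ∈ upperKappa T) (hab : a ≤ b) (hbt : b ≤ t) :
    HasDeltaDerivAt (T ∩ Ici b) x (g t (x t)) t :=
  (hx.2 t ht (hab.trans hbt)).mono (inter_subset_inter_right _ (Ici_subset_Ici.2 hab))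
    (by rw [sigma_inter_Ici hbt, sigma_inter_Ici (hab.trans hbt)])

theorem IsForwardSolution.restart {g : ℝ → E → E} (hx : IsForwardSolution T g a x₀ x)
    (hab : a ≤ b) : IsForwardSolution T g b (x b) x :=
  ⟨rfl, fun _ ht hbt => hx.hasDeltaDerivAt_Ici ht hab hbt⟩

/-- Allowing two forcing terms serves both uniqueness (`h = k`) and the comparison with approximate
solutions below. -/
theorem IsForwardSolution.norm_sub_le {y₀ : E} {k : ℝ → E}
    (hx : IsForwardSolution T (fun t w => N t w + h t) a x₀ x)
    (hy : IsForwardSolution T (fun t w => N t w + k t) a y₀ y) (hT : IsClosed T) (ha : a ∈ T)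
    (hb : b ∈ T) (hab : a ≤ b) {C c : ℝ} (hC : 0 ≤ C) (hc : 0 ≤ c)
    (hNC : ∀ t ∈ T, a ≤ t → t ≤ b → ‖N t‖ ≤ C) (hhc : ∀ t ∈ T, a ≤ t → t ≤ b → ‖h t - k t‖ ≤ c) :
    ‖x b - y b‖ ≤ (‖x₀ - y₀‖ + c * (b - a)) * Real.exp (C * (b - a)) := by
  have h1 := norm_le_of_norm_deltaDeriv_le (S := T ∩ Ici a) (a := a) (b := b)
    (w := fun t => x t - y t) (w' := fun t => N t (x t) + h t - (N t (y t) + k t)) (C := C) (c := c)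
    (hT.inter isClosed_Ici) ⟨ha, self_mem_Ici⟩ ⟨hb, hab⟩ hab hC hc
    ((hx.continuousOn.sub hy.continuousOn).mono inter_subset_left) ?_ ?_
  · simpa only [hx.1, hy.1] using h1
  · intro t ht hat htb
    have hκ := mem_upperKappa_of_lt ht.1 hb htb
    exact (hx.2 t hκ hat).sub (hy.2 t hκ hat)
  · intro t ht hat htb
    have e : N t (x t) + h t - (N t (y t) + k t) = N t (x t - y t) + (h t - k t) := by
      rw [map_sub]; abel
    rw [e]
    refine (norm_add_le _ _).trans (add_le_add ?_ (hhc t ht.1 hat htb.le))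
    exact (N t).le_of_opNorm_le (hNC t ht.1 hat htb.le) _

theorem IsForwardSolution.eq_of_mem (hx : IsForwardSolution T (fun t w => N t w + h t) a x₀ x)
    (hy : IsForwardSolution T (fun t w => N t w + h t) a x₀ y) (hN : RdContinuousFrom T a N)
    (hT : IsClosed T) (ha : a ∈ T) (hb : b ∈ T) (hab : a ≤ b) : x b = y b := by
  obtain ⟨C, hC, hNC⟩ := hN.exists_norm_le hT b
  have := hx.norm_sub_le hy hT ha hb hab hC le_rfl hNC (fun t _ _ _ => by simp)
  simpa [sub_eq_zero] using this

end Existence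

/-! ### Variation of constants without inverses. -/

section VariationOfConstants

variable {E : Type*} [NormedAddCommGroup E] [NormedSpace ℝ E] {T : Set ℝ} {f : ℝ → E}
  {a b r s : ℝ} {N : ℝ → E →L[ℝ] E} {x₀ v : E} {x : ℝ → E} {U : ℝ → ℝ → E →L[ℝ] E} {C ε : ℝ}

/-- `U t r` maps `c` to the value at `t` of the forward solution of `x^Δ = N x`, `x(r) = c`, for
all `r ∈ [a, ∞) ∩ T`. -/
def IsEvolution (T : Set ℝ) (N : ℝ → E →L[ℝ] E) (a : ℝ) (U : ℝ → ℝ → E →L[ℝ] E) : Prop :=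
  ∀ r ∈ T, a ≤ r → ∀ c, IsForwardSolution T (fun t w => N t w + 0) r c fun t => U t r c

theorem isForwardSolution_const_zero (T : Set ℝ) (N : ℝ → E →L[ℝ] E) (a : ℝ) :
    IsForwardSolution T (fun t w => N t w + 0) a 0 fun _ => 0 :=
  ⟨rfl, fun t _ _ => by simpa using hasDeltaDerivAt_const (T ∩ Ici a) (0 : E) t⟩

theorem IsEvolution.norm_apply_le (hU : IsEvolution T N a U) (hT : IsClosed T) (hC : 0 ≤ C)
    (hNC : ∀ t ∈ T, a ≤ t → t ≤ b → ‖N t‖ ≤ C) (hb : b ∈ T) (hs : s ∈ T) (has : a ≤ s)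
    (hsb : s ≤ b) (w : E) : ‖U b s w‖ ≤ Real.exp (C * (b - a)) * ‖w‖ := by
  have h1 := (hU s hs has w).norm_sub_le (isForwardSolution_const_zero T N s) hT hs hb hsb hC le_rfl
    (fun t ht h1 h2 => hNC t ht (has.trans h1) h2) (by simp)
  simp only [sub_zero, zero_mul, add_zero] at h1
  rw [mul_comm]
  refine h1.trans ?_
  gcongr

/-- Both sides, as functions of `b`, solve the same problem restarted at `s`. -/
theorem IsEvolution.comp_apply (hU : IsEvolution T N a U) (hT : IsClosed T)
    (hN : RdContinuousFrom T a N) (hb : b ∈ T) (hs : s ∈ T) (hr : r ∈ T) (har : a ≤ r)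
    (hrs : r ≤ s) (hsb : s ≤ b) (w : E) : U b s (U s r w) = U b r w :=
  (hU s hs (har.trans hrs) (U s r w)).eq_of_mem ((hU r hr har w).restart hrs)
    (hN.mono (har.trans hrs)) hT hs hb hsb

/-- The comparison function `U t r (x r) + (t - r) • v` solves the equation with forcing `v - N t
((t - r) • v)`, which differs from `f` by at most `ε + (s - r) C ‖v‖`. -/
theorem IsEvolution.norm_sub_apply_sub_le (hU : IsEvolution T N a U)
    (hx : IsForwardSolution T (fun t w => N t w + f t) a x₀ x) (hT : IsClosed T) (hC : 0 ≤ C)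
    (hNC : ∀ t ∈ T, a ≤ t → t ≤ b → ‖N t‖ ≤ C) (hr : r ∈ T) (hs : s ∈ T) (har : a ≤ r)
    (hrs : r ≤ s) (hsb : s ≤ b) (hε : 0 ≤ ε) (hfv : ∀ t ∈ T, r ≤ t → t ≤ s → ‖f t - v‖ ≤ ε) :
    ‖x s - U s r (x r) - (s - r) • v‖ ≤
      (ε + (s - r) * (C * ‖v‖)) * (s - r) * Real.exp (C * (b - a)) := by
  have hy : IsForwardSolution T (fun t w => N t w + (v - N t ((t - r) • v))) r (x r)
      fun t => U t r (x r) + (t - r) • v := by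
    refine ⟨by simp [(hU r hr har (x r)).1], fun t ht hrt => ?_⟩
    have e : N t (U t r (x r) + (t - r) • v) + (v - N t ((t - r) • v)) =
        N t (U t r (x r)) + 0 + v := by
      rw [map_add]; abel
    simp only [e]
    exact ((hU r hr har (x r)).2 t ht hrt).add (hasDeltaDerivAt_sub_smul_const _ r v t)
  have h0 : 0 ≤ s - r := sub_nonneg.2 hrs
  have h1 := (hx.restart har).norm_sub_le hy hT hr hs hrs hC
    (c := ε + (s - r) * (C * ‖v‖)) (by positivity)
    (fun t ht h1 h2 => hNC t ht (har.trans h1) (h2.trans hsb)) fun t ht h1 h2 => ?_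
  · rw [sub_self, norm_zero, zero_add] at h1
    rw [sub_sub]
    refine h1.trans ?_
    gcongr
  · have e : f t - (v - N t ((t - r) • v)) = (f t - v) + (t - r) • N t v := by
      rw [map_smul]; abel
    rw [e]
    refine (norm_add_le _ _).trans (add_le_add (hfv t ht h1 h2) ?_)
    rw [norm_smul, Real.norm_eq_abs, abs_of_nonneg (sub_nonneg.2 h1)]
    have := (N t).le_of_opNorm_le (hNC t ht (har.trans h1) (h2.trans hsb)) v
    gcongr

/-- The constant `v` is itself a solution, with forcing `-N t v`. The previous estimate, with `0` as
approximate forcing, bounds `v - U s r v`, and `U b s` carries this to `b`. -/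
theorem IsEvolution.norm_apply_sub_apply_le (hU : IsEvolution T N a U) (hT : IsClosed T)
    (hN : RdContinuousFrom T a N) (hC : 0 ≤ C) (hNC : ∀ t ∈ T, a ≤ t → t ≤ b → ‖N t‖ ≤ C)
    (hb : b ∈ T) (hr : r ∈ T) (hs : s ∈ T) (har : a ≤ r) (hrs : r ≤ s) (hsb : s ≤ b) (v : E) :
    ‖U b s v - U b r v‖ ≤ Real.exp (C * (b - a)) ^ 2 * ((s - r) * (C * ‖v‖)) := by
  have hx : IsForwardSolution T (fun t w => N t w + -N t v) a v fun _ => v :=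
    ⟨rfl, fun t _ _ => by simpa using hasDeltaDerivAt_const (T ∩ Ici a) v t⟩
  have h1 := hU.norm_sub_apply_sub_le hx hT hC hNC hr hs har hrs hsb (v := 0) (ε := C * ‖v‖)
    (by positivity) fun t ht h1 h2 => by
      simpa using (N t).le_of_opNorm_le (hNC t ht (har.trans h1) (h2.trans hsb)) v
  rw [smul_zero, sub_zero, norm_zero, mul_zero, mul_zero, add_zero] at h1
  rw [← hU.comp_apply hT hN hb hs hr har hrs hsb, ← map_sub]
  refine (hU.norm_apply_le hT hC hNC hb hs (har.trans hrs) hsb _).trans ?_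
  refine (mul_le_mul_of_nonneg_left h1 (Real.exp_nonneg _)).trans_eq ?_
  ring

/-- One exponential comes from Grönwall on `[r, s]`, the other from transport by `U b s`. -/
theorem IsEvolution.norm_apply_solution_sub_le (hU : IsEvolution T N a U)
    (hx : IsForwardSolution T (fun t w => N t w + f t) a x₀ x) (hT : IsClosed T)
    (hN : RdContinuousFrom T a N) (hC : 0 ≤ C) (hNC : ∀ t ∈ T, a ≤ t → t ≤ b → ‖N t‖ ≤ C)
    (hb : b ∈ T) (hr : r ∈ T) (hs : s ∈ T) (har : a ≤ r) (hrs : r ≤ s) (hsb : s ≤ b) (hε : 0 ≤ ε)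
    (hfv : ∀ t ∈ T, r ≤ t → t ≤ s → ‖f t - v‖ ≤ ε) :
    ‖U b s (x s) - U b r (x r) - (s - r) • U b s v‖ ≤
      Real.exp (C * (b - a)) ^ 2 * (ε + (s - r) * (C * ‖v‖)) * (s - r) := by
  have h1 := hU.norm_sub_apply_sub_le hx hT hC hNC hr hs har hrs hsb hε hfv
  have e : U b s (x s) - U b r (x r) - (s - r) • U b s v =
      U b s (x s - U s r (x r) - (s - r) • v) := by
    rw [← hU.comp_apply hT hN hb hs hr har hrs hsb, map_sub, map_sub, map_smul]
  rw [e]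
  refine (hU.norm_apply_le hT hC hNC hb hs (har.trans hrs) hsb _).trans ?_
  refine (mul_le_mul_of_nonneg_left h1 (Real.exp_nonneg _)).trans_eq ?_
  ring

theorem IsEvolution.continuousOn_apply_solution (hU : IsEvolution T N a U)
    (hx : IsForwardSolution T (fun t w => N t w + f t) a x₀ x) (hT : IsClosed T)
    (hN : RdContinuousFrom T a N) (hf : RdContinuousFrom T a f) (hb : b ∈ T) :
    ContinuousOn (fun s => U b s (x s)) (T ∩ Icc a b) := by
  obtain ⟨C, hC, hNC⟩ := hN.exists_norm_le hT b
  obtain ⟨c, hc, hfc⟩ := hf.exists_norm_le hT b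
  have key : ∀ r ∈ T ∩ Icc a b, ∀ s ∈ T ∩ Icc a b, r ≤ s → ‖U b s (x s) - U b r (x r)‖ ≤
      Real.exp (C * (b - a)) ^ 2 * c * |s - r| := by
    intro r hr s hs hrs
    have h1 := hU.norm_apply_solution_sub_le hx hT hN hC hNC hb hr.1 hs.1 hr.2.1 hrs hs.2.2 hc
      (v := 0) fun t ht h1 h2 => by simpa using hfc t ht (hr.2.1.trans h1) (h2.trans hs.2.2)
    simpa [abs_of_nonneg (sub_nonneg.2 hrs)] using h1
  have hlip : LipschitzOnWith (Real.toNNReal (Real.exp (C * (b - a)) ^ 2 * c))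
      (fun s => U b s (x s)) (T ∩ Icc a b) := by
    refine LipschitzOnWith.of_dist_le_mul fun s hs r hr => ?_
    rw [Real.coe_toNNReal _ (by positivity), dist_eq_norm, Real.dist_eq]
    rcases le_total r s with h | h
    · exact key r hr s hs h
    · rw [norm_sub_rev, abs_sub_comm]
      exact key s hs r hr h
  exact hlip.continuousOn

/-- At a right-scattered point, `U b (σ t)` is applied to `x(σ t) = U (σ t) t (x t) + (σ t - t) f
t`. At a right-dense point the preceding estimates leave an error that is small relative to the
step. -/
theorem IsEvolution.hasDeltaDerivAt_apply_solution (hU : IsEvolution T N a U)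
    (hx : IsForwardSolution T (fun t w => N t w + f t) a x₀ x) (hT : IsClosed T)
    (hN : RdContinuousFrom T a N) (hf : RdContinuousFrom T a f) (hb : b ∈ T) {t : ℝ} (ht : t ∈ T)
    (hat : a ≤ t) (htb : t < b) :
    HasDeltaDerivAt (T ∩ Icc a b) (fun s => U b s (x s)) (U b (sigma T t) (f t)) t := by
  have hκ := mem_upperKappa_of_lt ht hb htb
  have hσT : sigma T t ∈ T := sigma_mem hT ht
  have hσb : sigma T t ≤ b := sigma_le hb htb
  have hσ := sigma_inter_Icc hT ht hb hat htb
  rcases (le_sigma T t).eq_or_lt with h | h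
  · obtain ⟨C, hC, hNC⟩ := hN.exists_norm_le hT b
    intro ε hε
    rw [hσ, ← h]
    set K := Real.exp (C * (b - a)) ^ 2 with hK
    have hK0 : 0 < K := by positivity
    obtain ⟨δ, hδ, hball⟩ := Metric.continuousWithinAt_iff.1 ((hf t hκ hat).1 h.symm)
      (ε / (2 * K)) (by positivity)
    have hD : 0 ≤ C * ‖f t‖ := by positivity
    -- Here `t` will be either end of `[r, s]`, hence the choice of `q`. Half of `ε` covers the
    -- variation of `f`; the bound on `s - r` makes the two terms `K (s - r) C ‖f t‖` fit in the
    -- other half.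
    have key : ∀ r ∈ T, ∀ s ∈ T, a ≤ r → r ≤ s → s ≤ b → r ∈ Metric.ball t δ →
        s ∈ Metric.ball t δ → s - r ≤ ε / (4 * K * (C * ‖f t‖ + 1)) → ∀ q, q = r ∨ q = s →
        ‖U b s (x s) - U b r (x r) - (s - r) • U b q (f t)‖ ≤ ε * (s - r) := by
      intro r hr s hs har hrs hsb hrt hst hsr q hq
      have h0 : 0 ≤ s - r := sub_nonneg.2 hrs
      have h1 := hU.norm_apply_solution_sub_le hx hT hN hC hNC hb hr hs har hrs hsb
        (v := f t) (ε := ε / (2 * K)) (by positivity) fun p hp hrp hps => by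
          rw [← dist_eq_norm]
          refine (hball ⟨hp, har.trans hrp⟩ ?_).le
          rw [Real.ball_eq_Ioo] at hrt hst
          have : p ∈ Metric.ball t δ := by
            rw [Real.ball_eq_Ioo]
            exact ⟨hrt.1.trans_le hrp, hps.trans_lt hst.2⟩
          exact this
      have h2 : ‖U b s (f t) - U b q (f t)‖ ≤ K * ((s - r) * (C * ‖f t‖)) := by
        rcases hq with rfl | rfl
        · exact hU.norm_apply_sub_apply_le hT hN hC hNC hb hr hs har hrs hsb _
        · rw [sub_self, norm_zero]
          positivity
      have e : U b s (x s) - U b r (x r) - (s - r) • U b q (f t) =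
          (U b s (x s) - U b r (x r) - (s - r) • U b s (f t)) +
            (s - r) • (U b s (f t) - U b q (f t)) := by
        module
      rw [e]
      have h3 : (s - r) * (4 * K * (C * ‖f t‖ + 1)) ≤ ε := (le_div_iff₀ (by positivity)).1 hsr
      have h4 : K * (ε / (2 * K)) = ε / 2 := by field_simp
      calc _ ≤ K * (ε / (2 * K) + (s - r) * (C * ‖f t‖)) * (s - r) +
            (s - r) * (K * ((s - r) * (C * ‖f t‖))) := by
            refine (norm_add_le _ _).trans (add_le_add h1 ?_)
            rw [norm_smul, Real.norm_eq_abs, abs_of_nonneg h0]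
            gcongr
        _ = (K * (ε / (2 * K)) + 2 * (K * ((s - r) * (C * ‖f t‖)))) * (s - r) := by ring
        _ ≤ (ε / 2 + ε / 2) * (s - r) := by
            rw [h4]
            gcongr
            have : 0 ≤ K * (s - r) := by positivity
            linarith
        _ = ε * (s - r) := by ring
    have hη : 0 < ε / (4 * K * (C * ‖f t‖ + 1)) := by positivity
    filter_upwards [self_mem_nhdsWithin, mem_nhdsWithin_of_mem_nhds (Metric.ball_mem_nhds t hδ),
      mem_nhdsWithin_of_mem_nhds (Metric.ball_mem_nhds t hη)] with s hs hsδ hsη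
    rw [Metric.mem_ball, Real.dist_eq] at hsη
    have hsη' := abs_lt.1 hsη
    rcases le_total s t with hst | hst
    · rw [abs_of_nonneg (sub_nonneg.2 hst)]
      exact key s hs.1 t ht hs.2.1 hst htb.le hsδ (Metric.mem_ball_self hδ) (by linarith) t
        (Or.inr rfl)
    · rw [abs_sub_comm, abs_of_nonneg (sub_nonneg.2 hst), ← norm_neg]
      have := key t ht s hs.1 hat hst hs.2.2 (Metric.mem_ball_self hδ) hsδ (by linarith) t
        (Or.inl rfl)
      have e : -(U b t (x t) - U b s (x s) - (t - s) • U b t (f t)) =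
        U b s (x s) - U b t (x t) - (s - t) • U b t (f t) := by module
      rwa [e]
  · refine hasDeltaDerivAt_of_lt_sigma
      (hU.continuousOn_apply_solution hx hT hN hf hb t ⟨ht, hat, htb.le⟩) (by rwa [hσ]) ?_
    have h1 := (hx.2 t hκ hat).apply_sigma ⟨ht, hat⟩
    have h2 := ((hU t ht hat (x t)).2 t hκ le_rfl).apply_sigma ⟨ht, self_mem_Ici⟩
    rw [sigma_inter_Ici hat] at h1
    have h0 : U t t (x t) = x t := (hU t ht hat (x t)).1
    rw [sigma_inter_Ici le_rfl, h0] at h2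
    have h3 : x (sigma T t) = U (sigma T t) t (x t) + (sigma T t - t) • f t := by
      rw [h1, h2]
      simp only [add_zero, h0]
      module
    rw [hσ, h3, map_add, map_smul, hU.comp_apply hT hN hb hσT ht hat h.le hσb]

end VariationOfConstants

/-! ### Reflection of time scales, derivatives and solutions. -/

section Duality

variable {E : Type*} [NormedAddCommGroup E] [NormedSpace ℝ E] {T : Set ℝ} {f F : ℝ → E} {L : E}
  {a b s t : ℝ}

theorem mem_dual : s ∈ dual T ↔ -s ∈ T := Iff.rfl

theorem dual_dual (T : Set ℝ) : dual (dual T) = T := by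
  ext s
  simp [mem_dual]

theorem isClosed_dual (hT : IsClosed T) : IsClosed (dual T) := hT.preimage continuous_neg

theorem dual_inter_Ici (T : Set ℝ) (a : ℝ) : dual (T ∩ Ici a) = dual T ∩ Iic (-a) := by
  ext s
  simp [mem_dual, le_neg]

theorem dual_inter_Iic (T : Set ℝ) (a : ℝ) : dual (T ∩ Iic a) = dual T ∩ Ici (-a) := by
  ext s
  simp [mem_dual, neg_le]

theorem dual_inter_Icc (T : Set ℝ) (a b : ℝ) : dual (T ∩ Icc a b) = dual T ∩ Icc (-b) (-a) := by
  ext s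
  simp [mem_dual, le_neg, neg_le, and_comm]

theorem rho_dual (T : Set ℝ) (s : ℝ) : rho (dual T) s = -sigma T (-s) := by
  have e : dual T ∩ Iio s = -(T ∩ Ioi (-s)) := by
    ext r
    simp [mem_dual]
  unfold rho sigma
  rw [e, nonempty_neg, Real.sInf_def]
  split_ifs <;> simp

theorem sigma_dual (T : Set ℝ) (s : ℝ) : sigma (dual T) s = -rho T (-s) := by
  have := rho_dual (dual T) (-s)
  rw [dual_dual, neg_neg] at this
  rw [this, neg_neg]

theorem mem_lowerKappa_dual : s ∈ lowerKappa (dual T) ↔ -s ∈ upperKappa T := by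
  have h1 : IsLeast (dual T) s ↔ IsGreatest T (-s) := by
    constructor
    · rintro ⟨h, h'⟩
      exact ⟨h, fun r hr => le_neg.1 (h' (by simpa [mem_dual] using hr))⟩
    · rintro ⟨h, h'⟩
      exact ⟨h, fun r hr => neg_le_neg_iff.1 (h' hr)⟩
  have h2 : s < sigma (dual T) s ↔ rho T (-s) < -s := by
    rw [sigma_dual, lt_neg]
  unfold lowerKappa upperKappa
  simp only [mem_ofPred_eq, h1, h2, mem_dual]

theorem tendsto_neg_nhdsWithin_dual (T : Set ℝ) (t : ℝ) :
    Tendsto (fun s : ℝ => -s) (𝓝[dual T] (-t)) (𝓝[T] t) := by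
  have h : ContinuousWithinAt (fun s : ℝ => -s) (dual T) (-t) :=
    continuous_neg.continuousWithinAt
  have h1 := h.tendsto_nhdsWithin (t := T) fun s hs => hs
  rwa [neg_neg] at h1

theorem HasDeltaDerivAt.dualFun (h : HasDeltaDerivAt T f L t) :
    HasNablaDerivAt (dual T) (dualFun f) (-L) (-t) := by
  intro ε hε
  filter_upwards [(tendsto_neg_nhdsWithin_dual T t).eventually (h ε hε)] with s hs
  rw [rho_dual, neg_neg]
  simp only [TimeScale.dualFun, neg_neg]
  convert hs using 1
  · congr 1
    module
  · rw [← abs_neg]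
    congr 2
    ring

theorem HasNablaDerivAt.dualFun (h : HasNablaDerivAt T f L t) :
    HasDeltaDerivAt (dual T) (dualFun f) (-L) (-t) := by
  intro ε hε
  filter_upwards [(tendsto_neg_nhdsWithin_dual T t).eventually (h ε hε)] with s hs
  rw [sigma_dual, neg_neg]
  simp only [TimeScale.dualFun, neg_neg]
  convert hs using 1
  · congr 1
    module
  · rw [← abs_neg]
    congr 2
    ring

theorem LdContinuousOn.dualFun {E : Type*} [NormedAddCommGroup E] {T : Set ℝ} {f : ℝ → E}
    (h : LdContinuousOn (dual T) (lowerKappa (dual T)) f) :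
    RdContinuousOn T (upperKappa T) (dualFun f) := by
  have hmem : ∀ t, t ∈ upperKappa T → -t ∈ lowerKappa (dual T) := fun t ht => by
    rwa [mem_lowerKappa_dual, neg_neg]
  constructor
  · intro t ht hσ
    have h1 := h.1 (-t) (hmem t ht) (by rw [rho_dual, neg_neg, hσ])
    exact h1.comp continuous_neg.continuousWithinAt hmem
  · intro t ht hρ
    obtain ⟨l, hl⟩ := h.2 (-t) (hmem t ht) (by rw [sigma_dual, neg_neg, hρ])
    refine ⟨l, hl.comp ?_⟩
    have h1 : ContinuousWithinAt (fun s : ℝ => -s) (upperKappa T ∩ Iio t) t :=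
      continuous_neg.continuousWithinAt
    exact h1.tendsto_nhdsWithin fun s hs =>
      ⟨hmem s hs.1, mem_Ioi.2 (neg_lt_neg_iff.2 hs.2)⟩

theorem IsBackwardSolution.dualFun {g : ℝ → E → E} {y₀ : E} {y : ℝ → E}
    (hy : IsBackwardSolution (dual T) g (-a) y₀ y) :
    IsForwardSolution T (fun t w => -g (-t) w) a y₀ (dualFun y) := by
  refine ⟨hy.1, fun t ht hat => ?_⟩
  have h1 := (hy.2 (-t) (by rwa [mem_lowerKappa_dual, neg_neg]) (neg_le_neg hat)).dualFun
  rwa [dual_inter_Iic, dual_dual, neg_neg, neg_neg] at h1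

theorem IsForwardSolution.dualFun {g : ℝ → E → E} {x₀ : E} {x : ℝ → E}
    (hx : IsForwardSolution T (fun t w => -g (-t) w) a x₀ x) :
    IsBackwardSolution (dual T) g (-a) x₀ (dualFun x) := by
  refine ⟨by simpa [TimeScale.dualFun] using hx.1, fun s hs hsa => ?_⟩
  have h1 := (hx.2 (-s) (mem_lowerKappa_dual.1 hs) (le_neg.1 hsa)).dualFun
  rw [dual_inter_Ici, neg_neg, neg_neg] at h1
  exact h1

/-- The chosen antiderivative and `F` differ by a constant: Grönwall with `C = c = 0` is applied to
their reflected difference, normalised to vanish at `-b`. -/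
theorem nablaIntegral_eq_sub (hT : IsClosed T) (ha : a ∈ T) (hb : b ∈ T) (hab : a ≤ b)
    (hF : IsNablaAntideriv T f a b F) : nablaIntegral T f a b = F b - F a := by
  have hex : NablaIntegrable T f a b := ⟨F, hF⟩
  have hG := hex.choose_spec
  have hnI : nablaIntegral T f a b = hex.choose b - hex.choose a := dif_pos hex
  rw [hnI]
  generalize hex.choose = G at hG
  have hS : dual (T ∩ Icc a b) = dual T ∩ Icc (-b) (-a) := dual_inter_Icc T a b
  have h1 := norm_le_of_norm_deltaDeriv_le (S := dual (T ∩ Icc a b)) (a := -b) (b := -a)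
    (w := fun t => (dualFun G t - dualFun F t) - (G b - F b)) (w' := fun _ => 0) (C := 0) (c := 0)
    (isClosed_dual (hT.inter isClosed_Icc)) (by simpa [mem_dual] using ⟨hb, hab⟩)
    (by simpa [mem_dual] using ⟨ha, hab⟩) (neg_le_neg hab) le_rfl le_rfl ?_ ?_ (by simp)
  · simp only [dualFun, neg_neg, sub_self, norm_zero, zero_mul, add_zero] at h1
    have h2 := norm_le_zero_iff.1 h1
    rw [← neg_sub, neg_eq_zero] at h2
    rw [← sub_eq_zero, ← h2]
    abel
  · refine ContinuousOn.mono ?_ inter_subset_left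
    have hc : ∀ {H : ℝ → E}, ContinuousOn H (T ∩ Icc a b) →
        ContinuousOn (dualFun H) (dual (T ∩ Icc a b)) := fun hH =>
      hH.comp continuous_neg.continuousOn fun s hs => hs
    exact ((hc hG.1).sub (hc hF.1)).sub continuousOn_const
  · intro t ht hbt hta
    have hmem : -t ∈ T ∩ Ioc a b := ⟨ht.1, lt_neg.1 hta, neg_le.1 hbt⟩
    have h2 := (hG.2 _ hmem).dualFun.sub (hF.2 _ hmem).dualFun
    simpa using h2.sub (hasDeltaDerivAt_const _ (G b - F b) _)

end Duality

/-! ### Matrix equations and the transition function. -/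

section Matrix

variable {n m : ℕ} {T : Set ℝ} {a : ℝ} {A : ℝ → Matrix (Fin n) (Fin n) ℝ}

/-- Multiplication of a vector by a matrix, as a continuous bilinear map. -/
noncomputable def mulVecCLM (n m : ℕ) :
    Matrix (Fin n) (Fin m) ℝ →L[ℝ] (Fin m → ℝ) →L[ℝ] (Fin n → ℝ) :=
  (Matrix.mulVecBilin ℝ ℝ).toContinuousBilinearMap

/-- Multiplication of square matrices, as a continuous bilinear map. -/
noncomputable def mulCLM (n : ℕ) :
    Matrix (Fin n) (Fin n) ℝ →L[ℝ] Matrix (Fin n) (Fin n) ℝ →L[ℝ] Matrix (Fin n) (Fin n) ℝ :=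
  (LinearMap.mul ℝ (Matrix (Fin n) (Fin n) ℝ)).toContinuousBilinearMap

theorem RdContinuousFrom.clm_comp {E F : Type*} [NormedAddCommGroup E] [NormedSpace ℝ E]
    [NormedAddCommGroup F] [NormedSpace ℝ F] {f : ℝ → E} (hf : RdContinuousFrom T a f)
    (φ : E →L[ℝ] F) : RdContinuousFrom T a fun t => φ (f t) :=
  hf.comp₂ hf (φ := fun u _ => φ u) (φ.continuous.comp continuous_fst)

theorem isForwardSolution_transition (hT : IsClosed T) (hA : RdContinuousFrom T a A) (ha : a ∈ T) :
    IsForwardSolution T (fun τ M => A τ * M) a 1 fun t => transition T A t a := by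
  have : CompleteSpace (Matrix (Fin n) (Fin n) ℝ) := FiniteDimensional.complete ℝ _
  obtain ⟨X, hX⟩ := exists_isForwardSolution hT ha (hA.clm_comp (mulCLM n))
    (rdContinuousFrom_of_continuousOn (continuousOn_const (c := 0))) 1
  have hex : ∃ X : ℝ → Matrix (Fin n) (Fin n) ℝ,
      IsForwardSolution T (fun τ M => A τ * M) a 1 X := by
    simp only [add_zero] at hX
    exact ⟨X, hX⟩
  exact Classical.epsilon_spec hex

/-- Evaluation of a matrix at a fixed vector is linear and continuous, so it carries the matrix
solution to a vector solution. -/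
theorem isEvolution_transition (hT : IsClosed T) (hA : RdContinuousFrom T a A) :
    IsEvolution T (fun t => mulVecCLM n n (A t)) a fun t r => mulVecCLM n n (transition T A t r) := by
  intro r hr har c
  have h := isForwardSolution_transition hT (hA.mono har) hr
  refine ⟨?_, fun t ht hrt => ?_⟩
  · have h1 : transition T A r r = 1 := h.1
    change transition T A r r *ᵥ c = c
    rw [h1, Matrix.one_mulVec]
  · have h1 : HasDeltaDerivAt (T ∩ Ici r) (fun t => transition T A t r *ᵥ c)
        ((A t * transition T A t r) *ᵥ c) t := (h.2 t ht hrt).clm_apply ((mulVecCLM n n).flip c)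
    rw [← Matrix.mulVec_mulVec] at h1
    simp only [add_zero]
    exact h1

variable {f : ℝ → Fin n → ℝ} {x₀ : Fin n → ℝ} {x y : ℝ → Fin n → ℝ} {b t : ℝ}

theorem exists_isForwardSolution_mulVec (hT : IsClosed T) (hA : RdContinuousFrom T a A)
    (hf : RdContinuousFrom T a f) (ha : a ∈ T) (x₀ : Fin n → ℝ) :
    ∃ x, IsForwardSolution T (fun t w => A t *ᵥ w + f t) a x₀ x :=
  exists_isForwardSolution hT ha (hA.clm_comp (mulVecCLM n n)) hf x₀

theorem isForwardSolution_mulVec_unique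
    (hx : IsForwardSolution T (fun t w => A t *ᵥ w + f t) a x₀ x)
    (hy : IsForwardSolution T (fun t w => A t *ᵥ w + f t) a x₀ y) (hT : IsClosed T)
    (hA : RdContinuousFrom T a A) (ha : a ∈ T) (hb : b ∈ T) (hab : a ≤ b) : x b = y b :=
  IsForwardSolution.eq_of_mem (N := fun t => mulVecCLM n n (A t)) hx hy
    (hA.clm_comp (mulVecCLM n n)) hT ha hb hab

theorem continuousOn_transition_mulVec
    (hx : IsForwardSolution T (fun t w => A t *ᵥ w + f t) a x₀ x) (hT : IsClosed T)
    (hA : RdContinuousFrom T a A) (hf : RdContinuousFrom T a f) (hb : b ∈ T) :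
    ContinuousOn (fun s => transition T A b s *ᵥ x s) (T ∩ Icc a b) :=
  (isEvolution_transition hT hA).continuousOn_apply_solution hx hT (hA.clm_comp (mulVecCLM n n)) hf
    hb

theorem hasDeltaDerivAt_transition_mulVec
    (hx : IsForwardSolution T (fun t w => A t *ᵥ w + f t) a x₀ x) (hT : IsClosed T)
    (hA : RdContinuousFrom T a A) (hf : RdContinuousFrom T a f) (hb : b ∈ T) (ht : t ∈ T)
    (hat : a ≤ t) (htb : t < b) :
    HasDeltaDerivAt (T ∩ Icc a b) (fun s => transition T A b s *ᵥ x s)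
      (transition T A b (sigma T t) *ᵥ f t) t :=
  (isEvolution_transition hT hA).hasDeltaDerivAt_apply_solution hx hT
    (hA.clm_comp (mulVecCLM n n)) hf hb ht hat htb

theorem RdContinuousFrom.mulVec {B : ℝ → Matrix (Fin n) (Fin m) ℝ} {u : ℝ → Fin m → ℝ}
    (hB : RdContinuousFrom T a B) (hu : RdContinuousFrom T a u) :
    RdContinuousFrom T a fun t => B t *ᵥ u t :=
  hB.comp₂ hu (φ := fun M w => M *ᵥ w) (continuous_fst.matrix_mulVec continuous_snd)

end Matrix

end TimeScale

/-! ### The dual control system. -/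

open TimeScale
theorem proposition3p3 {n m : ℕ} (T : Set ℝ) (hT : IsTimeScale T)
    (A : ℝ → Matrix (Fin n) (Fin n) ℝ) (hA : RdContinuousOn T (upperKappa T) A)
    (B : ℝ → Matrix (Fin n) (Fin m) ℝ) (hB : RdContinuousOn T (upperKappa T) B)
    (Abar : ℝ → Matrix (Fin n) (Fin n) ℝ) (hAbar : Abar = -dualFun A)
    (Bbar : ℝ → Matrix (Fin n) (Fin m) ℝ) (hBbar : Bbar = -dualFun B)
    (v : ℝ → Fin m → ℝ) (hv : LdContinuousOn (dual T) (lowerKappa (dual T)) v)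
    (s₀ : ℝ) (hs₀ : s₀ ∈ dual T) (x₀ : Fin n → ℝ) :
    ∃ y : ℝ → Fin n → ℝ,
      IsBackwardSolution (dual T) (fun s w => Abar s *ᵥ w + Bbar s *ᵥ v s) s₀ x₀ y ∧
      (∀ z : ℝ → Fin n → ℝ,
        IsBackwardSolution (dual T) (fun s w => Abar s *ᵥ w + Bbar s *ᵥ v s) s₀ x₀ z →
          ∀ s ∈ dual T, s ≤ s₀ → z s = y s) ∧
      ∀ s ∈ dual T, s ≤ s₀ →
        NablaIntegrable (dual T)
          (fun ς => dualTransition T A s (rho (dual T) ς) *ᵥ (Bbar ς *ᵥ v ς)) s s₀ ∧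
        y s = dualTransition T A s s₀ *ᵥ x₀ -
          nablaIntegral (dual T)
            (fun ς => dualTransition T A s (rho (dual T) ς) *ᵥ (Bbar ς *ᵥ v ς)) s s₀ := by
  obtain ⟨a, rfl⟩ : ∃ a, s₀ = -a := ⟨-s₀, (neg_neg s₀).symm⟩
  have hTc := hT.2
  have ha : a ∈ T := by simpa [mem_dual] using hs₀
  have hA' := hA.rdContinuousFrom a
  have hf : RdContinuousFrom T a fun t => B t *ᵥ v (-t) :=
    (hB.rdContinuousFrom a).mulVec (hv.dualFun.rdContinuousFrom a)
  -- The sign produced by reflection cancels the signs in `Ā` and `B̄`.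
  have hg : (fun t w => -(Abar (-t) *ᵥ w + Bbar (-t) *ᵥ v (-t))) =
      fun t w => A t *ᵥ w + B t *ᵥ v (-t) := by
    funext t w
    simp only [hAbar, hBbar, Pi.neg_apply, dualFun, neg_neg, Matrix.neg_mulVec, neg_add]
  obtain ⟨x, hx⟩ := exists_isForwardSolution_mulVec hTc hA' hf ha x₀
  have hx' := hx
  rw [← hg] at hx'
  refine ⟨dualFun x, IsForwardSolution.dualFun hx', fun z hz s hs hsa => ?_, fun s hs hsa => ?_⟩
  · have hz' := hz.dualFun
    rw [hg] at hz'
    have h1 := isForwardSolution_mulVec_unique hz' hx hTc hA' ha hs (le_neg.1 hsa)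
    simpa only [dualFun, neg_neg] using h1
  · obtain ⟨b, rfl⟩ : ∃ b, s = -b := ⟨-s, (neg_neg s).symm⟩
    have hb : b ∈ T := by simpa [mem_dual] using hs
    have hab : a ≤ b := neg_le_neg_iff.1 hsa
    -- The antiderivative is the reflection of `τ ↦ Φ(b, τ) x(τ)`; `ρ̂(ς) = -σ(-ς)` turns `Φ(b,
    -- σ(-ς))` into `Ψ(-b, ρ̂(ς))`.
    have hF : IsNablaAntideriv (dual T)
        (fun ς => dualTransition T A (-b) (rho (dual T) ς) *ᵥ (Bbar ς *ᵥ v ς)) (-b) (-a)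
        (dualFun fun τ => transition T A b τ *ᵥ x τ) := by
      rw [IsNablaAntideriv, ← dual_inter_Icc]
      refine ⟨(continuousOn_transition_mulVec hx hTc hA' hf hb).comp continuous_neg.continuousOn
        fun s hs => hs, fun ς hς => ?_⟩
      have h1 := (hasDeltaDerivAt_transition_mulVec hx hTc hA' hf hb (t := -ς) hς.1
        (le_neg.1 hς.2.2) (neg_lt.1 hς.2.1)).dualFun
      have e : dualTransition T A (-b) (rho (dual T) ς) *ᵥ (Bbar ς *ᵥ v ς) =
          -(transition T A b (sigma T (-ς)) *ᵥ (B (-ς) *ᵥ v ς)) := by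
        rw [hBbar, dualTransition, rho_dual, neg_neg, neg_neg, Pi.neg_apply, Matrix.neg_mulVec,
          Matrix.mulVec_neg, dualFun]
      rw [neg_neg] at h1
      rw [e]
      exact h1
    refine ⟨⟨_, hF⟩, ?_⟩
    -- The integral is `Φ(b, a) x(a) - Φ(b, b) x(b)`, and `Φ(b, b) = 1` isolates `x(b) = y(s)`.
    rw [nablaIntegral_eq_sub (isClosed_dual hTc) hs hs₀ hsa hF]
    have h1 : transition T A b b = 1 := (isForwardSolution_transition hTc (hA'.mono hab) hb).1
    have h2 : x a = x₀ := hx.1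
    simp only [dualFun, dualTransition, neg_neg, h1, h2, Matrix.one_mulVec]
    abel
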